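/- Let $n\in\mathbb N$, $\hbar>0$, $\mathbb T^n=\mathbb R^n/\mathbb Z^n$ with normalised Haar measure, and $e_b[x]=e^{2\pi i b\cdot x}$ for $b\in\mathbb Z^n$; write $\psi_b$ for the class of $e_b$ in $L^2(\mathbb T^n)$. Let $\mathcal S_{\mathcal R}(T^*\mathbb T^n)$ be the complex linear span of the functions $e_b\otimes h_{U,\xi,g}$ on $T^*\mathbb T^n=\mathbb T^n\times\mathbb R^n$, where $b\in\mathbb Z^n$, $U\subseteq\mathbb R^n$ is a linear subspace with orthogonal projection $P_U$, $\xi\in U^\perp$, $g\in\mathcal S(U)$ is a Schwartz function, and $h_{U,\xi,g}(p)=e^{i\xi\cdot p}g(P_Up)$. Let $\mathcal Q_\hbar^{\mathrm W}\colon\mathcal S_{\mathcal R}(T^*\mathbb T^n)\to\mathcal B(L^2(\mathbb T^n))$ be the Weyl quantization, i.e. the unique linear map such that $$\mathcal Q_\hbar^{\mathrm W}(e_b\otimes h)\psi_a=h\big(2\pi\hbar(a+\tfrac12 b)\big)\,\psi_{a+b}\qquad(a\in\mathbb Z^n)$$ for all generators $e_b\otimes h$, $h=h_{U,\xi,g}$.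 Let the quantum resolvent algebra $A_\hbar\subseteq\mathcal B(L^2(\mathbb T^n))$ be the C*-subalgebra generated by the image of $\mathcal Q_\hbar^{\mathrm W}$. Let $V\in C(\mathbb T^n)$ be real-valued, let $M_V$ be the operator of multiplication by $V$ on $L^2(\mathbb T^n)$, let $H_0$ be the closure of the operator $-\frac{\hbar^2}{2}\sum_j\frac{d^2}{dx_j^2}$ with domain $C^\infty(\mathbb T^n)$, and let $H:=H_0+M_V$ with domain $\operatorname{dom}H_0$. Then $H$ is self-adjoint (for $V=0$ this says that $H_0$ is the unique self-adjoint extension of the operator on $C^\infty(\mathbb T^n)$), there is exactly one strongly continuous one-parameter unitary group $\big(e^{-itH/\hbar}\big)_{t\in\mathbb R}$ with infinitesimal generator $-iH/\hbar$, and the automorphisms $\tau_t(O)=e^{itH/\hbar}\,O\,e^{-itH/\hbar}$ of $\mathcal B(L^2(\mathbb T^n))$ satisfy $$\tau_t(A_\hbar)=A_\hbar\qquad\text{for all }t\in\mathbb R.$$ -/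

import Mathlib

open MeasureTheory UnitAddTorus
open scoped ENNReal ContDiff InnerProductSpace SchwartzMap

noncomputable section

namespace TorusResolvent

/-! ### The torus, its Hilbert space, and the plane waves -/

/-- The torus `𝕋ⁿ = (ℝ/ℤ)ⁿ`. -/
abbrev Torus (n : ℕ) : Type := UnitAddTorus (Fin n)

/-- The momentum space `ℝⁿ`, with its Euclidean inner product. -/
abbrev Momentum (n : ℕ) : Type := EuclideanSpace ℝ (Fin n)

/-- The normalised Haar measure on `𝕋ⁿ`. -/
abbrev torusMeasure (n : ℕ) : Measure (Torus n) :=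
  Measure.pi fun _ => AddCircle.haarAddCircle

/-- The Hilbert space `L²(𝕋ⁿ)`. -/
abbrev L2Torus (n : ℕ) : Type := Lp ℂ 2 (torusMeasure n)

/-- The class in `L²(𝕋ⁿ)` of a continuous function. -/
abbrev toL2 (n : ℕ) : C(Torus n, ℂ) →L[ℂ] L2Torus n :=
  ContinuousMap.toLp 2 (torusMeasure n) ℂ

/-- The plane wave `ψ_a[x] = exp (2πi a·x)` as an element of `L²(𝕋ⁿ)`. -/
def planeWave {n : ℕ} (a : Fin n → ℤ) : L2Torus n := toL2 n (mFourier a)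

/-- The plane waves form a Hilbert basis of `L²(𝕋ⁿ)`. -/
def planeWaveBasis (n : ℕ) : HilbertBasis (Fin n → ℤ) ℂ (L2Torus n) := mFourierBasis

theorem planeWaveBasis_apply {n : ℕ} (a : Fin n → ℤ) : planeWaveBasis n a = planeWave a :=
  congrFun (coe_mFourierBasis (d := Fin n)) a

/-- Multiplication `M_V` by a continuous function `V`, as a bounded operator on `L²(𝕋ⁿ)`. -/
def multiplicationOp {n : ℕ} (V : C(Torus n, ℂ)) : L2Torus n →L[ℂ] L2Torus n :=
  (ContinuousLinearMap.mul ℂ ℂ).holderL (torusMeasure n) ∞ 2 2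
    (ContinuousMap.toLp ∞ (torusMeasure n) ℂ V)

theorem multiplicationOp_coeFn {n : ℕ} (V : C(Torus n, ℂ)) (ψ : L2Torus n) :
    multiplicationOp V ψ =ᵐ[torusMeasure n] fun x => V x * ψ x := by
  have h1 := (ContinuousLinearMap.mul ℂ ℂ).coeFn_holder (r := 2)
    (ContinuousMap.toLp (p := ∞) (torusMeasure n) ℂ V) ψ
  have h2 := ContinuousMap.coeFn_toLp (p := ∞) (𝕜 := ℂ) (torusMeasure n) V
  filter_upwards [h1, h2] with x hx hx'
  rw [← hx']
  exact hx

theorem multiplicationOp_toL2 {n : ℕ} (V f : C(Torus n, ℂ)) :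
    multiplicationOp V (toL2 n f) = toL2 n (V * f) := by
  apply Lp.ext
  filter_upwards [multiplicationOp_coeFn V (toL2 n f),
    ContinuousMap.coeFn_toLp (p := 2) (𝕜 := ℂ) (torusMeasure n) f,
    ContinuousMap.coeFn_toLp (p := 2) (𝕜 := ℂ) (torusMeasure n) (V * f)] with x h1 h2 h3
  rw [h1, h2, h3]
  rfl

/-! ### The classical symbols `S_R(T*𝕋ⁿ)` -/

/-- The function `h_{U,ξ,g}(p) = exp (i ξ·p) g(P_U p)` on `ℝⁿ`, with `P_U` the orthogonal
projection onto `U`. -/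
def momentumSymbol {n : ℕ} (U : Submodule ℝ (Momentum n)) (ξ : Momentum n) (g : 𝓢(U, ℂ)) :
    Momentum n → ℂ :=
  fun p => Complex.exp (Complex.I * (⟪ξ, p⟫_ℝ : ℝ)) * g (U.orthogonalProjectionOnto p)

/-- The function `e_b ⊗ h` on `T*𝕋ⁿ = 𝕋ⁿ × ℝⁿ`, where `e_b[x] = exp (2πi b·x)`. -/
def tensorSymbol {n : ℕ} (b : Fin n → ℤ) (h : Momentum n → ℂ) : Torus n × Momentum n → ℂ :=
  fun x => mFourier b x.1 * h x.2

/-- `S_R(T*𝕋ⁿ)`: the span of the functions `e_b ⊗ h_{U,ξ,g}` with `b ∈ ℤⁿ`, `U ⊆ ℝⁿ` a linear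
subspace, `ξ ∈ Uᗮ` and `g` a Schwartz function on `U`. -/
def symbolSpace (n : ℕ) : Submodule ℂ (Torus n × Momentum n → ℂ) :=
  Submodule.span ℂ {f | ∃ (b : Fin n → ℤ) (U : Submodule ℝ (Momentum n)) (ξ : Momentum n)
    (g : 𝓢(U, ℂ)), ξ ∈ Uᗮ ∧ f = tensorSymbol b (momentumSymbol U ξ g)}

theorem tensorSymbol_mem {n : ℕ} (b : Fin n → ℤ) (U : Submodule ℝ (Momentum n))
    {ξ : Momentum n} (hξ : ξ ∈ Uᗮ) (g : 𝓢(U, ℂ)) :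
    tensorSymbol b (momentumSymbol U ξ g) ∈ symbolSpace n :=
  Submodule.subset_span ⟨b, U, ξ, g, hξ, rfl⟩

/-! ### Weyl quantization -/

/-- The point `2πħ (a + b/2)` of momentum space. -/
def midMomentum {n : ℕ} (ħ : ℝ) (a b : Fin n → ℤ) : Momentum n :=
  WithLp.toLp 2 fun j => 2 * Real.pi * ħ * ((a j : ℝ) + (b j : ℝ) / 2)

/-- The defining property of Weyl quantization: `Q(e_b ⊗ h) ψ_a = h(2πħ(a + b/2)) ψ_{a+b}` for all
generators `e_b ⊗ h`, `h = h_{U,ξ,g}`, of `S_R(T*𝕋ⁿ)` and all `a ∈ ℤⁿ`. -/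
def IsWeylQuantization {n : ℕ} (ħ : ℝ)
    (Q : symbolSpace n →ₗ[ℂ] (L2Torus n →L[ℂ] L2Torus n)) : Prop :=
  ∀ (b : Fin n → ℤ) (U : Submodule ℝ (Momentum n)) (ξ : Momentum n) (hξ : ξ ∈ Uᗮ) (g : 𝓢(U, ℂ))
    (a : Fin n → ℤ),
    Q ⟨tensorSymbol b (momentumSymbol U ξ g), tensorSymbol_mem b U hξ g⟩ (planeWave a) =
      momentumSymbol U ξ g (midMomentum ħ a b) • planeWave (a + b)

theorem momentumSymbol_bounded {n : ℕ} (U : Submodule ℝ (Momentum n)) (ξ : Momentum n)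
    (g : 𝓢(U, ℂ)) : ∃ C : ℝ, ∀ p, ‖momentumSymbol U ξ g p‖ ≤ C := by
  obtain ⟨C, -, hC⟩ := g.decay 0 0
  refine ⟨C, fun p => ?_⟩
  have h1 : ‖Complex.exp (Complex.I * (⟪ξ, p⟫_ℝ : ℝ))‖ = 1 := by
    rw [mul_comm]; exact Complex.norm_exp_ofReal_mul_I _
  rw [momentumSymbol, norm_mul, h1, one_mul]
  simpa using hC (U.orthogonalProjectionOnto p)

theorem exists_diagonal {ι E : Type*} [NormedAddCommGroup E] [InnerProductSpace ℂ E]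
    (e : HilbertBasis ι ℂ E) (m : ι → ℂ) (C : ℝ) (hm : ∀ i, ‖m i‖ ≤ C) :
    ∃ D : E →L[ℂ] E, ∀ i, D (e i) = m i • e i := by
  classical
  have hle : ∀ (c : lp (fun _ : ι => ℂ) 2) (i : ι), ‖m i * c i‖ ≤ ‖((C : ℂ) • c) i‖ := by
    intro c i
    have h0 : 0 ≤ C := (norm_nonneg _).trans (hm i)
    rw [lp.coeFn_smul, Pi.smul_apply, norm_mul, norm_smul, Complex.norm_real,
      Real.norm_of_nonneg h0]
    exact mul_le_mul_of_nonneg_right (hm i) (norm_nonneg _)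
  have hmem : ∀ c : lp (fun _ : ι => ℂ) 2, Memℓp (fun i => m i * c i) 2 := fun c =>
    (lp.memℓp ((C : ℂ) • c)).mono' (hle c)
  let L : lp (fun _ : ι => ℂ) 2 →ₗ[ℂ] lp (fun _ : ι => ℂ) 2 :=
    { toFun := fun c => ⟨fun i => m i * c i, hmem c⟩
      map_add' := fun c d => by ext i; exact mul_add _ _ _
      map_smul' := fun k c => by ext i; exact mul_left_comm _ _ _ }
  have hL : ∀ c, ‖L c‖ ≤ ‖(C : ℂ)‖ * ‖c‖ := fun c =>
    (lp.norm_mono (by norm_num) (hle c)).trans (lp.norm_const_smul_le (by norm_num) _ _)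
  refine ⟨(e.repr.symm.toContinuousLinearEquiv : lp (fun _ : ι => ℂ) 2 →L[ℂ] E) ∘L
    (L.mkContinuous _ hL) ∘L (e.repr.toContinuousLinearEquiv : E →L[ℂ] _), fun i => ?_⟩
  apply e.repr.injective
  ext j
  have h1 : e.repr (e i) = lp.single 2 i 1 := e.repr_self i
  simp only [ContinuousLinearMap.comp_apply, map_smul, h1]
  change e.repr (e.repr.symm (L (e.repr (e i)))) j = _
  rw [e.repr.apply_symm_apply, h1]
  change m j * (lp.single 2 i (1 : ℂ) : lp (fun _ : ι => ℂ) 2) j =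
    m i * (lp.single 2 i (1 : ℂ) : lp (fun _ : ι => ℂ) 2) j
  by_cases hij : j = i
  · rw [hij]
  · rw [lp.single_apply_ne _ _ _ hij, mul_zero, mul_zero]

theorem exists_quantized {n : ℕ} (ħ : ℝ) (b : Fin n → ℤ) (h : Momentum n → ℂ) (C : ℝ)
    (hC : ∀ p, ‖h p‖ ≤ C) : ∃ T : L2Torus n →L[ℂ] L2Torus n,
      ∀ a, T (planeWave a) = h (midMomentum ħ a b) • planeWave (a + b) := by
  obtain ⟨D, hD⟩ := exists_diagonal (planeWaveBasis n) (fun a => h (midMomentum ħ a b)) C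
    fun _ => hC _
  refine ⟨multiplicationOp (mFourier b) ∘L D, fun a => ?_⟩
  have hmul : mFourier b * mFourier a = mFourier (a + b) := by
    ext x
    rw [ContinuousMap.mul_apply, mul_comm, mFourier_add]
  rw [ContinuousLinearMap.comp_apply, ← planeWaveBasis_apply, hD, planeWaveBasis_apply, map_smul,
    planeWave, multiplicationOp_toL2, hmul, planeWave]

theorem clm_ext_planeWave {n : ℕ} {S T : L2Torus n →L[ℂ] L2Torus n}
    (h : ∀ a, S (planeWave a) = T (planeWave a)) : S = T := by
  refine ContinuousLinearMap.ext_on ?_ (fun x hx => ?_) (s := Set.range (planeWaveBasis n))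
  · rw [Submodule.dense_iff_topologicalClosure_eq_top]
    exact (planeWaveBasis n).dense_span
  · obtain ⟨a, rfl⟩ := hx
    simpa only [planeWaveBasis_apply] using h a

/-- The matrix elements of the quantization of `f`, in terms of the Fourier coefficients of
`f(·, p)`. -/
def symbolMatrix {n : ℕ} (ħ : ℝ) (f : Torus n × Momentum n → ℂ) (a c : Fin n → ℤ) : ℂ :=
  ∫ q, mFourier (-(c - a)) q * f (q, midMomentum ħ a (c - a)) ∂(torusMeasure n)

theorem integral_mFourier {n : ℕ} (k l : Fin n → ℤ) :
    ∫ q, mFourier (-k) q * mFourier l q ∂(torusMeasure n) = if k = l then 1 else 0 := by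
  have h := orthonormal_iff_ite.mp (planeWaveBasis n).orthonormal k l
  rw [planeWaveBasis_apply, planeWaveBasis_apply, planeWave, planeWave,
    ContinuousMap.inner_toLp] at h
  rw [← h]
  refine integral_congr_ae (Filter.Eventually.of_forall fun q => ?_)
  simp only [mFourier_neg]
  ring

theorem symbolMatrix_tensorSymbol {n : ℕ} (ħ : ℝ) (b : Fin n → ℤ) (h : Momentum n → ℂ)
    (a c : Fin n → ℤ) : ⟪planeWave c, h (midMomentum ħ a b) • planeWave (a + b)⟫_ℂ =
      symbolMatrix ħ (tensorSymbol b h) a c := by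
  have h1 := orthonormal_iff_ite.mp (planeWaveBasis n).orthonormal c (a + b)
  rw [planeWaveBasis_apply, planeWaveBasis_apply] at h1
  rw [inner_smul_right, h1]
  simp only [symbolMatrix, tensorSymbol, ← mul_assoc]
  rw [integral_mul_const, integral_mFourier]
  by_cases hc : c = a + b
  · subst hc
    simp
  · rw [if_neg hc, if_neg (fun h => hc (by rw [← h]; abel)), mul_zero, zero_mul]

theorem continuous_of_mem_symbolSpace {n : ℕ} {f : Torus n × Momentum n → ℂ}
    (hf : f ∈ symbolSpace n) (p : Momentum n) : Continuous fun q => f (q, p) := by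
  induction hf using Submodule.span_induction with
  | mem f hf =>
    obtain ⟨b, U, ξ, g, -, rfl⟩ := hf
    have h : Continuous fun _ : Torus n => momentumSymbol U ξ g p := continuous_const
    exact (mFourier b).continuous.mul h
  | zero => exact continuous_const
  | add f g _ _ hf hg => exact hf.add hg
  | smul c f _ hf => exact hf.const_smul c

theorem integrable_symbol {n : ℕ} {f : Torus n × Momentum n → ℂ} (hf : f ∈ symbolSpace n)
    (k : Fin n → ℤ) (p : Momentum n) :
    Integrable (fun q => mFourier k q * f (q, p)) (torusMeasure n) :=
  ((mFourier k).continuous.mul (continuous_of_mem_symbolSpace hf p)).integrable_of_hasCompactSupport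
    (HasCompactSupport.of_compactSpace _)

theorem symbolMatrix_add {n : ℕ} (ħ : ℝ) {f g : Torus n × Momentum n → ℂ}
    (hf : f ∈ symbolSpace n) (hg : g ∈ symbolSpace n) (a c : Fin n → ℤ) :
    symbolMatrix ħ (f + g) a c = symbolMatrix ħ f a c + symbolMatrix ħ g a c := by
  rw [symbolMatrix, symbolMatrix, symbolMatrix,
    ← integral_add (integrable_symbol hf _ _) (integrable_symbol hg _ _)]
  simp only [Pi.add_apply, mul_add]

theorem symbolMatrix_smul {n : ℕ} (ħ : ℝ) (k : ℂ) (f : Torus n × Momentum n → ℂ)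
    (a c : Fin n → ℤ) : symbolMatrix ħ (k • f) a c = k * symbolMatrix ħ f a c := by
  rw [symbolMatrix, symbolMatrix, ← integral_const_mul]
  refine integral_congr_ae (Filter.Eventually.of_forall fun q => ?_)
  simp only [Pi.smul_apply, smul_eq_mul]
  ring

theorem exists_matrix {n : ℕ} (ħ : ℝ) {f : Torus n × Momentum n → ℂ} (hf : f ∈ symbolSpace n) :
    ∃ T : L2Torus n →L[ℂ] L2Torus n,
      ∀ a c, ⟪planeWave c, T (planeWave a)⟫_ℂ = symbolMatrix ħ f a c := by
  induction hf using Submodule.span_induction with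
  | mem f hf =>
    obtain ⟨b, U, ξ, g, -, rfl⟩ := hf
    obtain ⟨C, hC⟩ := momentumSymbol_bounded U ξ g
    obtain ⟨T, hT⟩ := exists_quantized ħ b (momentumSymbol U ξ g) C hC
    exact ⟨T, fun a c => by rw [hT, symbolMatrix_tensorSymbol]⟩
  | zero => exact ⟨0, fun a c => by simp [symbolMatrix]⟩
  | add f g hf hg hS hT =>
    obtain ⟨S, hS⟩ := hS
    obtain ⟨T, hT⟩ := hT
    refine ⟨S + T, fun a c => ?_⟩
    rw [_root_.add_apply, inner_add_right, hS, hT, symbolMatrix_add ħ hf hg]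
  | smul k f _ hT =>
    obtain ⟨T, hT⟩ := hT
    refine ⟨k • T, fun a c => ?_⟩
    rw [_root_.smul_apply, inner_smul_right, hT, symbolMatrix_smul]

theorem clm_ext_matrix {n : ℕ} {S T : L2Torus n →L[ℂ] L2Torus n}
    (h : ∀ a c : Fin n → ℤ, ⟪planeWave c, S (planeWave a)⟫_ℂ = ⟪planeWave c, T (planeWave a)⟫_ℂ) :
    S = T := by
  refine clm_ext_planeWave fun a => (planeWaveBasis n).repr.injective ?_
  ext c
  rw [HilbertBasis.repr_apply_apply, HilbertBasis.repr_apply_apply, planeWaveBasis_apply, h]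

theorem existsUnique_weylQuantization (n : ℕ) (ħ : ℝ) :
    ∃! Q : symbolSpace n →ₗ[ℂ] (L2Torus n →L[ℂ] L2Torus n), IsWeylQuantization ħ Q := by
  choose T hT using fun f : symbolSpace n => exists_matrix ħ f.2
  refine ⟨{ toFun := T, map_add' := fun f g => ?_, map_smul' := fun k f => ?_ }, ?_, ?_⟩
  · refine clm_ext_matrix fun a c => ?_
    rw [_root_.add_apply, inner_add_right, hT, hT, hT, ← symbolMatrix_add ħ f.2 g.2]
    rfl
  · refine clm_ext_matrix fun a c => ?_
    rw [RingHom.id_apply, _root_.smul_apply, inner_smul_right, hT, hT,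
      ← symbolMatrix_smul]
    rfl
  · intro b U ξ hξ g a
    refine (planeWaveBasis n).repr.injective ?_
    ext c
    rw [HilbertBasis.repr_apply_apply, HilbertBasis.repr_apply_apply, planeWaveBasis_apply,
      symbolMatrix_tensorSymbol]
    exact hT _ a c
  · intro Q hQ
    ext1 ⟨f, hf⟩
    change Q ⟨f, hf⟩ = T ⟨f, hf⟩
    refine clm_ext_matrix fun a c => ?_
    rw [hT]
    induction hf using Submodule.span_induction with
    | mem f hf' =>
      obtain ⟨b, U, ξ, g, hξ, rfl⟩ := hf'
      rw [hQ b U ξ hξ g a, symbolMatrix_tensorSymbol]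
    | zero =>
      have : Q ⟨0, Submodule.zero_mem _⟩ = 0 := map_zero Q
      rw [this]
      simp [symbolMatrix]
    | add f g hf hg h1 h2 =>
      have : Q ⟨f + g, Submodule.add_mem _ hf hg⟩ = Q ⟨f, hf⟩ + Q ⟨g, hg⟩ :=
        map_add Q ⟨f, hf⟩ ⟨g, hg⟩
      rw [this, _root_.add_apply, inner_add_right, h1, h2]
      exact (symbolMatrix_add ħ hf hg a c).symm
    | smul k f hf h1 =>
      have : Q ⟨k • f, Submodule.smul_mem _ k hf⟩ = k • Q ⟨f, hf⟩ := map_smul Q k ⟨f, hf⟩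
      rw [this, _root_.smul_apply, inner_smul_right, h1]
      exact (symbolMatrix_smul ħ k f a c).symm

/-- The Weyl quantization map `Q_ħ : S_R(T*𝕋ⁿ) → B(L²(𝕋ⁿ))`. -/
def weylQuantization (n : ℕ) (ħ : ℝ) :
    symbolSpace n →ₗ[ℂ] (L2Torus n →L[ℂ] L2Torus n) :=
  (existsUnique_weylQuantization n ħ).choose

theorem isWeylQuantization (n : ℕ) (ħ : ℝ) : IsWeylQuantization ħ (weylQuantization n ħ) :=
  (existsUnique_weylQuantization n ħ).choose_spec.1

/-- The quantum resolvent algebra `A_ħ`: the C*-subalgebra of `B(L²(𝕋ⁿ))` generated by the range of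
Weyl quantization, i.e. the norm closure of the generated *-algebra. -/
def resolventAlgebra (n : ℕ) (ħ : ℝ) : NonUnitalStarSubalgebra ℂ (L2Torus n →L[ℂ] L2Torus n) :=
  (NonUnitalStarAlgebra.adjoin ℂ (Set.range (weylQuantization n ħ))).topologicalClosure

/-! ### The Hamiltonian -/

/-- The covering map `ℝⁿ → 𝕋ⁿ`. -/
def torusProj (n : ℕ) : Momentum n → Torus n := fun x j => (x j : UnitAddCircle)

theorem isOpenQuotientMap_torusProj (n : ℕ) : IsOpenQuotientMap (torusProj n) := by
  have h : IsOpenQuotientMap (Pi.map fun (_ : Fin n) (t : ℝ) => (t : UnitAddCircle)) :=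
    IsOpenQuotientMap.piMap fun _ => QuotientAddGroup.isOpenQuotientMap_mk
  exact h.comp (EuclideanSpace.equiv (Fin n) ℝ).toHomeomorph.isOpenQuotientMap

/-- `C^∞(𝕋ⁿ)`: the functions whose pullback to `ℝⁿ` is smooth. -/
def smoothFunctions (n : ℕ) : Submodule ℂ C(Torus n, ℂ) where
  carrier := {f | ContDiff ℝ ∞ (f ∘ torusProj n)}
  add_mem' {f g} hf hg := by
    have hf' : ContDiff ℝ ∞ (f ∘ torusProj n) := hf
    have hg' : ContDiff ℝ ∞ (g ∘ torusProj n) := hg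
    exact hf'.add hg'
  zero_mem' := by
    have h : ContDiff ℝ ∞ (fun _ : Momentum n => (0 : ℂ)) := contDiff_const
    exact h
  smul_mem' c f hf := by
    have hf' : ContDiff ℝ ∞ (f ∘ torusProj n) := hf
    exact hf'.const_smul c

theorem contDiff_of_mem_smoothFunctions {n : ℕ} {f : C(Torus n, ℂ)} (hf : f ∈ smoothFunctions n) :
    ContDiff ℝ 2 (f ∘ torusProj n) := by
  have h : ContDiff ℝ ∞ (f ∘ torusProj n) := hf
  exact contDiff_infty.mp h 2

/-- The Laplacian `Σ d²/dx_j²` of a function on `𝕋ⁿ`, computed on its pullback to `ℝⁿ`. -/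
def torusLaplacianFun {n : ℕ} (f : Torus n → ℂ) : Torus n → ℂ :=
  fun q => Laplacian.laplacian (f ∘ torusProj n)
    (Function.surjInv (isOpenQuotientMap_torusProj n).surjective q)

/-- The Laplacian on the torus does not depend on the chosen lifts. -/
theorem torusLaplacianFun_comp {n : ℕ} (f : Torus n → ℂ) :
    torusLaplacianFun f ∘ torusProj n = Laplacian.laplacian (f ∘ torusProj n) := by
  funext x
  set y := Function.surjInv (isOpenQuotientMap_torusProj n).surjective (torusProj n x) with hy
  have hyx : torusProj n y = torusProj n x := Function.surjInv_eq _ _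
  have hper : ∀ z, (f ∘ torusProj n) (z + (y - x)) = (f ∘ torusProj n) z := by
    intro z
    have : torusProj n (z + (y - x)) = torusProj n z := by
      funext j
      have hj : ((y j : ℝ) : UnitAddCircle) = (x j : ℝ) := congrFun hyx j
      simp only [torusProj, PiLp.add_apply, PiLp.sub_apply, AddCircle.coe_add, AddCircle.coe_sub]
      rw [hj, sub_self, add_zero]
    simp only [Function.comp_apply, this]
  change Laplacian.laplacian (f ∘ torusProj n) y = _
  rw [InnerProductSpace.laplacian_eq_iteratedFDeriv_stdOrthonormalBasis]
  have h := fun z => iteratedFDeriv_comp_add_right (𝕜 := ℝ) (f := f ∘ torusProj n) 2 (y - x) z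
  simp only [hper] at h
  have h2 := h x
  rw [add_sub_cancel] at h2
  simp only [← h2]

theorem continuous_torusLaplacianFun {n : ℕ} {f : C(Torus n, ℂ)} (hf : f ∈ smoothFunctions n) :
    Continuous (torusLaplacianFun f) := by
  rw [← (isOpenQuotientMap_torusProj n).continuous_comp_iff, torusLaplacianFun_comp,
    InnerProductSpace.laplacian_eq_iteratedFDeriv_stdOrthonormalBasis]
  have hc : Continuous (iteratedFDeriv ℝ 2 (f ∘ torusProj n)) :=
    ContDiff.continuous_iteratedFDeriv le_rfl (contDiff_of_mem_smoothFunctions hf)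
  fun_prop

/-- The Laplacian as a linear map `C^∞(𝕋ⁿ) → C(𝕋ⁿ)`. -/
def torusLaplacian (n : ℕ) : smoothFunctions n →ₗ[ℂ] C(Torus n, ℂ) where
  toFun f := ⟨torusLaplacianFun f.1, continuous_torusLaplacianFun f.2⟩
  map_add' f g := by
    ext q
    have hf : ContDiff ℝ 2 (f.1 ∘ torusProj n) := contDiff_of_mem_smoothFunctions f.2
    have hg : ContDiff ℝ 2 (g.1 ∘ torusProj n) := contDiff_of_mem_smoothFunctions g.2
    exact hf.contDiffAt.laplacian_add hg.contDiffAt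
  map_smul' c f := by
    ext q
    have hf : ContDiff ℝ 2 (f.1 ∘ torusProj n) := contDiff_of_mem_smoothFunctions f.2
    exact InnerProductSpace.laplacian_smul c hf.contDiffAt

/-- The operator `-(ħ²/2) Σ d²/dx_j²` on `L²(𝕋ⁿ)` with domain `C^∞(𝕋ⁿ)`, given by its graph. -/
def smoothFreeHamiltonian (n : ℕ) (ħ : ℝ) : L2Torus n →ₗ.[ℂ] L2Torus n :=
  (LinearMap.range
    (((toL2 n : C(Torus n, ℂ) →ₗ[ℂ] L2Torus n) ∘ₗ (smoothFunctions n).subtype).prod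
      ((-(ħ ^ 2 / 2 : ℝ) : ℂ) •
        ((toL2 n : C(Torus n, ℂ) →ₗ[ℂ] L2Torus n) ∘ₗ torusLaplacian n)))).toLinearPMap

theorem mem_graph_smoothFreeHamiltonian {n : ℕ} {ħ : ℝ} {ψ φ : L2Torus n} :
    (ψ, φ) ∈ (smoothFreeHamiltonian n ħ).graph ↔ ∃ f : smoothFunctions n,
      toL2 n f.1 = ψ ∧ (-(ħ ^ 2 / 2 : ℝ) : ℂ) • toL2 n (torusLaplacian n f) = φ := by
  rw [smoothFreeHamiltonian, Submodule.toLinearPMap_graph_eq]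
  · simp only [LinearMap.mem_range, LinearMap.prod_apply, Prod.ext_iff]
    rfl
  · rintro x ⟨f, rfl⟩ hx
    have h0 : toL2 n f.1 = toL2 n 0 := by rw [map_zero]; exact hx
    have hf : f = 0 := Subtype.ext (ContinuousMap.toLp_injective (torusMeasure n) h0)
    rw [hf, map_zero]
    rfl

/-- The free Hamiltonian `H₀`, the closure of `-(ħ²/2) Σ d²/dx_j²` on `C^∞(𝕋ⁿ)`. -/
def freeHamiltonian (n : ℕ) (ħ : ℝ) : L2Torus n →ₗ.[ℂ] L2Torus n :=
  (smoothFreeHamiltonian n ħ).closure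

/-- A real-valued continuous function on `𝕋ⁿ`, regarded as complex-valued. -/
def complexify {n : ℕ} (V : C(Torus n, ℝ)) : C(Torus n, ℂ) :=
  ⟨fun x => (V x : ℂ), Complex.continuous_ofReal.comp V.continuous⟩

/-- The Hamiltonian `H = H₀ + M_V` with domain `dom H₀`. -/
def hamiltonian {n : ℕ} (ħ : ℝ) (V : C(Torus n, ℝ)) : L2Torus n →ₗ.[ℂ] L2Torus n :=
  freeHamiltonian n ħ +
    (multiplicationOp (complexify V) : L2Torus n →ₗ[ℂ] L2Torus n).toPMap ⊤

theorem hamiltonian_domain {n : ℕ} (ħ : ℝ) (V : C(Torus n, ℝ)) :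
    (hamiltonian ħ V).domain = (freeHamiltonian n ħ).domain :=
  inf_top_eq _

/-! ### Quantum time evolution -/

/-- `IsSchrodingerGroup ħ H U` says that `U t = exp (-itH/ħ)` for all real `t`: `U` is the strongly
continuous one-parameter unitary group whose infinitesimal generator (with its exact domain) is
`-iH/ħ`. -/
structure IsSchrodingerGroup {E : Type*} [NormedAddCommGroup E] [InnerProductSpace ℂ E]
    [CompleteSpace E] (ħ : ℝ) (H : E →ₗ.[ℂ] E) (U : ℝ → unitary (E →L[ℂ] E)) : Prop where
  map_zero : U 0 = 1
  map_add : ∀ s t, U (s + t) = U s * U t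
  continuous : ∀ ψ : E, Continuous fun t => (U t : E →L[ℂ] E) ψ
  generator : ∀ ψ φ : E, (ψ, φ) ∈ H.graph ↔
    Filter.Tendsto (fun t : ℝ => ((t : ℂ)⁻¹) • ((U t : E →L[ℂ] E) ψ - ψ))
      (nhdsWithin 0 {0}ᶜ) (nhds ((-(Complex.I / (ħ : ℂ))) • φ))

/-- The automorphisms `τ_t(O) = U(t)* O U(t)` of `B(E)` associated with `U`; for
`U t = exp (-itH/ħ)` this is `exp (itH/ħ) O exp (-itH/ħ)`. -/
def timeEvolution {E : Type*} [NormedAddCommGroup E] [InnerProductSpace ℂ E]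
    [CompleteSpace E] (U : ℝ → unitary (E →L[ℂ] E)) (t : ℝ) : (E →L[ℂ] E) ≃⋆ₐ[ℂ] (E →L[ℂ] E) :=
  Unitary.conjStarAlgAut ℂ (E →L[ℂ] E) (star (U t))

theorem timeEvolution_apply {E : Type*} [NormedAddCommGroup E] [InnerProductSpace ℂ E]
    [CompleteSpace E] (U : ℝ → unitary (E →L[ℂ] E)) (t : ℝ) (O : E →L[ℂ] E) :
    timeEvolution U t O = star (U t : E →L[ℂ] E) * O * (U t : E →L[ℂ] E) :=
  Unitary.conjStarAlgAut_star_apply _ _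

end TorusResolvent

end

open MeasureTheory UnitAddTorus
open scoped ENNReal ContDiff InnerProductSpace SchwartzMap FourierTransform

noncomputable section

namespace TorusResolvent

/-! ### Diagonal operators in a Hilbert basis -/

section Diagonal

variable {ι E : Type*} [NormedAddCommGroup E] [InnerProductSpace ℂ E]

/-! The plane waves diagonalise `H₀`, and its closure is the maximal operator with those eigenvalues
(`isDiagonal_freeHamiltonian`). The eigenvalues tend to infinity, so the resolvent of `H₀` is
compact. A Neumann series carries compactness over to the resolvent of `H = H₀ + M_V`, and the
spectral theorem gives `H` an eigenbasis with its maximal domain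
(`IsDiagonal.exists_isDiagonal_add`). Self-adjointness and existence of the unitary group are then
read off coordinatewise, and uniqueness is Duhamel's formula with zero perturbation.

For `V = 0`, conjugation by `U₀(t)` multiplies the symbol `e_b ⊗ h` by the character `exp (2πi t
b·p)`, exactly: the energy difference between `ψ_{a+b}` and `ψ_a` is linear in the Weyl midpoint
(`freeEnergy_add_sub`). The functions `h_{U,ξ,g}` are stable under multiplication by characters, so
the free evolution preserves the algebra `A`.

For general `V`, put `W(t) = U₀(-t) U(t)`. Then `τ_t(O)` is the free evolution of `O` conjugated by
`W(t)`, and it suffices that `W(t) ∈ A`. Let `K_δ = ∫₀^δ U₀(-s) M_V U₀(s) ds`. In operator norm,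
`U(δ) = U₀(δ)(1 - (i/ħ) K_δ) + O(δ²)`; composing `N` steps of length `t/N` leaves an error `O(1/N)`,
so only `K_δ ∈ A` is needed (`neg_mul_mem_of_conjIntegral_mem`).

The integral defining `K_δ` is only a strong one, so membership of the integrand in `A` is not
enough. For `V = e_b`, however, `K_δ` has symbol `e_b ⊗ F(b·p)` with `F(x) = ∫₀^δ exp (2πi s x) ds`.
This `F` is the inverse Fourier transform of an integrable function, hence a uniform limit of
Schwartz functions, and those give elements of `A` (`conjIntegral_mFourier_mem`). Density of
trigonometric polynomials handles all continuous `V`. -/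

theorem HilbertBasis.ext_inner (e : HilbertBasis ι ℂ E) {x y : E}
    (h : ∀ i, ⟪e i, x⟫_ℂ = ⟪e i, y⟫_ℂ) : x = y := by
  apply e.repr.injective
  ext i
  rw [e.repr_apply_apply, e.repr_apply_apply, h]

theorem HilbertBasis.clm_ext {F : Type*} [NormedAddCommGroup F] [NormedSpace ℂ F]
    (e : HilbertBasis ι ℂ E) {S T : E →L[ℂ] F}
    (h : ∀ i, S (e i) = T (e i)) : S = T := by
  refine ContinuousLinearMap.ext_on (s := Set.range e) ?_ ?_
  · rw [Submodule.dense_iff_topologicalClosure_eq_top]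
    exact e.dense_span
  · rintro x ⟨i, rfl⟩
    exact h i

open Classical in
/-- The bounded operator with eigenvectors `e i` and (bounded) eigenvalues `m i`. -/
def diagonalOp (e : HilbertBasis ι ℂ E) (m : ι → ℂ) : E →L[ℂ] E :=
  if h : ∃ C : ℝ, ∀ i, ‖m i‖ ≤ C then (exists_diagonal e m h.choose h.choose_spec).choose else 0

theorem diagonalOp_apply (e : HilbertBasis ι ℂ E) {m : ι → ℂ} {C : ℝ} (hm : ∀ i, ‖m i‖ ≤ C)
    (i : ι) : diagonalOp e m (e i) = m i • e i := by
  have h : ∃ C : ℝ, ∀ i, ‖m i‖ ≤ C := ⟨C, hm⟩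
  rw [diagonalOp, dif_pos h]
  exact (exists_diagonal e m h.choose h.choose_spec).choose_spec i

/-- Both sides are continuous functionals of `x` that agree on the basis. Identities between
diagonal operators can thus be checked one coordinate at a time. -/
theorem HilbertBasis.inner_apply_of_diagonal (e : HilbertBasis ι ℂ E) {D : E →L[ℂ] E}
    {m : ι → ℂ} (hD : ∀ i, D (e i) = m i • e i) (i : ι) (x : E) :
    ⟪e i, D x⟫_ℂ = m i * ⟪e i, x⟫_ℂ := by
  have h : (innerSL ℂ (e i)).comp D = m i • innerSL ℂ (e i) := by
    classical
    refine HilbertBasis.clm_ext e fun j => ?_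
    have h1 := orthonormal_iff_ite.mp e.orthonormal i j
    simp only [ContinuousLinearMap.comp_apply, hD, _root_.smul_apply, innerSL_apply_apply,
      inner_smul_right, h1, smul_eq_mul]
    by_cases hij : i = j
    · rw [hij]
    · simp [hij]
  have := congrArg (fun T : E →L[ℂ] ℂ => T x) h
  simpa using this

theorem inner_diagonalOp (e : HilbertBasis ι ℂ E) {m : ι → ℂ} {C : ℝ} (hm : ∀ i, ‖m i‖ ≤ C)
    (i : ι) (x : E) : ⟪e i, diagonalOp e m x⟫_ℂ = m i * ⟪e i, x⟫_ℂ :=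
  HilbertBasis.inner_apply_of_diagonal e (diagonalOp_apply e hm) i x

/-- Parseval: the norm is the `ℓ²` norm of the coordinates, which is monotone in their moduli. -/
theorem norm_le_of_inner_le (e : HilbertBasis ι ℂ E) {x y : E}
    (h : ∀ i, ‖⟪e i, x⟫_ℂ‖ ≤ ‖⟪e i, y⟫_ℂ‖) : ‖x‖ ≤ ‖y‖ := by
  rw [← e.repr.norm_map x, ← e.repr.norm_map y]
  refine lp.norm_mono (by norm_num) fun i => ?_
  rw [e.repr_apply_apply, e.repr_apply_apply]
  exact h i

theorem norm_diagonalOp_le (e : HilbertBasis ι ℂ E) {m : ι → ℂ} {C : ℝ} (hC : 0 ≤ C)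
    (hm : ∀ i, ‖m i‖ ≤ C) : ‖diagonalOp e m‖ ≤ C := by
  refine ContinuousLinearMap.opNorm_le_bound _ hC fun x => ?_
  have h : ‖diagonalOp e m x‖ ≤ ‖(C : ℂ) • x‖ := by
    refine norm_le_of_inner_le e fun i => ?_
    rw [inner_diagonalOp e hm, inner_smul_right, norm_mul, norm_mul, Complex.norm_real,
      Real.norm_of_nonneg hC]
    exact mul_le_mul_of_nonneg_right (hm i) (norm_nonneg _)
  rwa [norm_smul, Complex.norm_real, Real.norm_of_nonneg hC] at h

theorem star_diagonalOp [CompleteSpace E] (e : HilbertBasis ι ℂ E) {m : ι → ℂ} {C : ℝ}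
    (hm : ∀ i, ‖m i‖ ≤ C) : star (diagonalOp e m) = diagonalOp e (fun i => star (m i)) := by
  have hm' : ∀ i, ‖star (m i)‖ ≤ C := fun i => by rw [norm_star]; exact hm i
  ext x
  refine HilbertBasis.ext_inner e fun i => ?_
  rw [inner_diagonalOp e hm', ContinuousLinearMap.star_eq_adjoint,
    ContinuousLinearMap.adjoint_inner_right, diagonalOp_apply e hm, inner_smul_left]
  rfl

theorem diagonalOp_mul (e : HilbertBasis ι ℂ E) {m k : ι → ℂ} {C D : ℝ}
    (hm : ∀ i, ‖m i‖ ≤ C) (hk : ∀ i, ‖k i‖ ≤ D) :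
    diagonalOp e m * diagonalOp e k = diagonalOp e (fun i => m i * k i) := by
  have hmk : ∀ i, ‖m i * k i‖ ≤ C * D := fun i => by
    rw [norm_mul]
    exact mul_le_mul (hm i) (hk i) (norm_nonneg _) ((norm_nonneg _).trans (hm i))
  ext x
  refine HilbertBasis.ext_inner e fun i => ?_
  rw [ContinuousLinearMap.mul_def, ContinuousLinearMap.comp_apply, inner_diagonalOp e hm, inner_diagonalOp e hk,
    inner_diagonalOp e hmk, mul_assoc]

theorem diagonalOp_one (e : HilbertBasis ι ℂ E) : diagonalOp e (fun _ => 1) = 1 := by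
  ext x
  refine HilbertBasis.ext_inner e fun i => ?_
  rw [inner_diagonalOp e (C := 1) (fun _ => by simp), one_mul]
  rfl

/-- The operator `H` is diagonal in the Hilbert basis `e` with eigenvalues `l`, on its maximal
domain. -/
def IsDiagonal (e : HilbertBasis ι ℂ E) (l : ι → ℝ) (H : E →ₗ.[ℂ] E) : Prop :=
  ∀ ψ φ, (ψ, φ) ∈ H.graph ↔ ∀ i, ⟪e i, φ⟫_ℂ = l i * ⟪e i, ψ⟫_ℂ

theorem IsDiagonal.basis_mem {e : HilbertBasis ι ℂ E} {l : ι → ℝ} {H : E →ₗ.[ℂ] E}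
    (h : IsDiagonal e l H) (i : ι) : (e i, (l i : ℂ) • e i) ∈ H.graph := by
  classical
  refine (h _ _).mpr fun j => ?_
  rw [inner_smul_right, orthonormal_iff_ite.mp e.orthonormal j i]
  by_cases hij : j = i
  · rw [hij]
  · simp [hij]

theorem IsDiagonal.dense_domain {e : HilbertBasis ι ℂ E} {l : ι → ℝ} {H : E →ₗ.[ℂ] E}
    (h : IsDiagonal e l H) : Dense (H.domain : Set E) := by
  have hle : Submodule.span ℂ (Set.range e) ≤ H.domain := by
    rw [Submodule.span_le]
    rintro _ ⟨i, rfl⟩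
    exact LinearPMap.mem_domain_of_mem_graph (h.basis_mem i)
  refine Dense.mono hle ?_
  rw [Submodule.dense_iff_topologicalClosure_eq_top]
  exact e.dense_span

/-! ### The unitary group generated by a diagonal operator -/

/-- The phase `exp (-itl/ħ)`. -/
def phase (ħ l t : ℝ) : ℂ := Complex.exp ((-(t * l / ħ) : ℝ) * Complex.I)

theorem norm_phase (ħ l t : ℝ) : ‖phase ħ l t‖ = 1 := Complex.norm_exp_ofReal_mul_I _

theorem norm_phase_le (ħ l t : ℝ) : ‖phase ħ l t‖ ≤ 1 := (norm_phase ħ l t).le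

theorem phase_zero (ħ l : ℝ) : phase ħ l 0 = 1 := by simp [phase]

theorem phase_add (ħ l s t : ℝ) : phase ħ l (s + t) = phase ħ l s * phase ħ l t := by
  rw [phase, phase, phase, ← Complex.exp_add]
  congr 1
  push_cast
  ring

theorem star_phase (ħ l t : ℝ) : star (phase ħ l t) = phase ħ l (-t) := by
  rw [phase, phase, Complex.star_def, ← Complex.exp_conj]
  congr 1
  simp [neg_div]

theorem hasDerivAt_phase (ħ l t : ℝ) :
    HasDerivAt (phase ħ l) (-(Complex.I / ħ) * l * phase ħ l t) t := by
  have h1 : HasDerivAt (fun t : ℝ => ((-(t * l / ħ) : ℝ) : ℂ)) ((-(1 * l / ħ) : ℝ) : ℂ) t :=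
    ((((hasDerivAt_id t).mul_const l).div_const ħ).neg).ofReal_comp
  have h2 := (h1.mul_const Complex.I).cexp
  refine h2.congr_deriv ?_
  rw [← phase]
  push_cast
  ring

theorem continuous_phase (ħ l : ℝ) : Continuous (phase ħ l) :=
  continuous_iff_continuousAt.mpr fun t => (hasDerivAt_phase ħ l t).continuousAt

variable [CompleteSpace E]

/-- The unitary group `exp (-itH/ħ)` of the operator `H` with eigenvectors `e i` and real
eigenvalues `l i`. -/
def diagonalGroup (ħ : ℝ) (e : HilbertBasis ι ℂ E) (l : ι → ℝ) (t : ℝ) : unitary (E →L[ℂ] E) :=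
  ⟨diagonalOp e fun i => phase ħ (l i) t, by
    have h : ∀ t, star (diagonalOp e fun i => phase ħ (l i) t) =
        diagonalOp e fun i => phase ħ (l i) (-t) := fun t => by
      rw [star_diagonalOp e fun i => norm_phase_le _ _ _]
      simp only [star_phase]
    rw [Unitary.mem_iff, h, diagonalOp_mul e (fun i => norm_phase_le _ _ _)
      (fun i => norm_phase_le _ _ _), diagonalOp_mul e (fun i => norm_phase_le _ _ _)
      (fun i => norm_phase_le _ _ _)]
    simp only [← phase_add, neg_add_cancel, add_neg_cancel, phase_zero, diagonalOp_one,
      and_self]⟩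

theorem diagonalGroup_apply (ħ : ℝ) (e : HilbertBasis ι ℂ E) (l : ι → ℝ) (t : ℝ) (i : ι) :
    (diagonalGroup ħ e l t : E →L[ℂ] E) (e i) = phase ħ (l i) t • e i :=
  diagonalOp_apply e (fun _ => norm_phase_le _ _ _) i

theorem inner_diagonalGroup (ħ : ℝ) (e : HilbertBasis ι ℂ E) (l : ι → ℝ) (t : ℝ) (i : ι) (x : E) :
    ⟪e i, (diagonalGroup ħ e l t : E →L[ℂ] E) x⟫_ℂ = phase ħ (l i) t * ⟪e i, x⟫_ℂ :=
  inner_diagonalOp e (fun _ => norm_phase_le _ _ _) i x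

theorem diagonalGroup_zero (ħ : ℝ) (e : HilbertBasis ι ℂ E) (l : ι → ℝ) :
    diagonalGroup ħ e l 0 = 1 := by
  ext x
  refine HilbertBasis.ext_inner e fun i => ?_
  rw [inner_diagonalGroup, phase_zero, one_mul]
  rfl

theorem diagonalGroup_add (ħ : ℝ) (e : HilbertBasis ι ℂ E) (l : ι → ℝ) (s t : ℝ) :
    diagonalGroup ħ e l (s + t) = diagonalGroup ħ e l s * diagonalGroup ħ e l t := by
  ext x
  refine HilbertBasis.ext_inner e fun i => ?_
  rw [inner_diagonalGroup, Submonoid.coe_mul, ContinuousLinearMap.mul_def, ContinuousLinearMap.comp_apply, inner_diagonalGroup,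
    inner_diagonalGroup, phase_add, mul_assoc]

theorem norm_unitary_apply (u : unitary (E →L[ℂ] E)) (x : E) : ‖(u : E →L[ℂ] E) x‖ = ‖x‖ :=
  ContinuousLinearMap.norm_map_of_mem_unitary u.2 x

/-- Vectors with continuous orbit form a subspace, closed because unitarity turns limits of vectors
into uniform limits of orbits; it contains the basis. -/
theorem continuous_diagonalGroup (ħ : ℝ) (e : HilbertBasis ι ℂ E) (l : ι → ℝ) (x : E) :
    Continuous fun t => (diagonalGroup ħ e l t : E →L[ℂ] E) x := by
  let S : Submodule ℂ E :=
    { carrier := {x | Continuous fun t => (diagonalGroup ħ e l t : E →L[ℂ] E) x}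
      add_mem' := fun {x y} hx hy => by
        simp only [Set.mem_ofPred_eq, map_add] at hx hy ⊢
        exact hx.add hy
      zero_mem' := by simpa using continuous_const
      smul_mem' := fun c x hx => by
        simp only [Set.mem_ofPred_eq, map_smul] at hx ⊢
        exact hx.const_smul c }
  have hcl : IsClosed (S : Set E) := by
    refine isClosed_of_closure_subset fun x hx => ?_
    refine continuous_of_uniform_approx_of_continuous fun u hu => ?_
    obtain ⟨ε, hε, hu⟩ := Metric.mem_uniformity_dist.mp hu
    obtain ⟨y, hy, hxy⟩ := Metric.mem_closure_iff.mp hx ε hε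
    refine ⟨fun t => (diagonalGroup ħ e l t : E →L[ℂ] E) y, hy, fun t => hu ?_⟩
    rwa [dist_eq_norm, ← map_sub, norm_unitary_apply, ← dist_eq_norm]
  have hle : Submodule.span ℂ (Set.range e) ≤ S := by
    rw [Submodule.span_le]
    rintro _ ⟨i, rfl⟩
    change Continuous fun t => (diagonalGroup ħ e l t : E →L[ℂ] E) (e i)
    simp only [diagonalGroup_apply]
    exact (continuous_phase ħ (l i)).smul continuous_const
  have := (Submodule.topologicalClosure_minimal _ hle hcl)
  rw [e.dense_span] at this
  exact this trivial

/-! ### Self-adjointness and the generator property of diagonal operators -/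

/-- Testing a pair in the adjoint graph against the eigenvectors already forces the coordinate
relations that define the maximal domain; the converse is Parseval with real eigenvalues. -/
theorem IsDiagonal.isSelfAdjoint {e : HilbertBasis ι ℂ E} {l : ι → ℝ} {H : E →ₗ.[ℂ] E}
    (h : IsDiagonal e l H) : IsSelfAdjoint H := by
  rw [LinearPMap.isSelfAdjoint_def]
  apply LinearPMap.eq_of_eq_graph
  rw [LinearPMap.adjoint_graph_eq_graph_adjoint h.dense_domain]
  ext ⟨ψ, φ⟩
  rw [h, Submodule.mem_adjoint_iff]
  constructor
  · intro hψ i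
    have := hψ _ _ (h.basis_mem i)
    rw [inner_smul_left, Complex.conj_ofReal] at this
    exact (sub_eq_zero.mp this).symm
  · intro hψ x y hxy
    rw [h] at hxy
    rw [sub_eq_zero, ← e.tsum_inner_mul_inner, ← e.tsum_inner_mul_inner]
    refine tsum_congr fun i => ?_
    rw [hψ, ← inner_conj_symm, hxy, map_mul, Complex.conj_ofReal, inner_conj_symm]
    ring

/-- In each coordinate this is the fundamental theorem of calculus for the phase. The integrated
form upgrades coordinatewise differentiability to differentiability in norm. -/
theorem IsDiagonal.diagonalGroup_sub {e : HilbertBasis ι ℂ E} {l : ι → ℝ} {H : E →ₗ.[ℂ] E}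
    (h : IsDiagonal e l H) (ħ : ℝ) {ψ φ : E} (hψ : (ψ, φ) ∈ H.graph) (t : ℝ) :
    (diagonalGroup ħ e l t : E →L[ℂ] E) ψ - ψ =
      ∫ s in (0 : ℝ)..t, (diagonalGroup ħ e l s : E →L[ℂ] E) ((-(Complex.I / (ħ : ℂ))) • φ) := by
  refine HilbertBasis.ext_inner e fun i => ?_
  have hc := continuous_diagonalGroup ħ e l ((-(Complex.I / (ħ : ℂ))) • φ)
  have h1 := (innerSL ℂ (e i)).intervalIntegral_comp_comm (hc.intervalIntegrable (μ := volume) 0 t)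
  simp only [innerSL_apply_apply] at h1
  rw [← h1, inner_sub_right]
  simp only [inner_diagonalGroup, inner_smul_right, (h _ _).mp hψ i]
  have h2 : ∀ s ∈ Set.uIcc 0 t, HasDerivAt (fun s => phase ħ (l i) s * ⟪e i, ψ⟫_ℂ)
      (phase ħ (l i) s * (-(Complex.I / (ħ : ℂ)) * (l i * ⟪e i, ψ⟫_ℂ))) s := fun s _ => by
    refine ((hasDerivAt_phase ħ (l i) s).mul_const ⟪e i, ψ⟫_ℂ).congr_deriv ?_
    ring
  rw [intervalIntegral.integral_eq_sub_of_hasDerivAt h2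
    (Continuous.intervalIntegrable ((continuous_phase ħ (l i)).mul continuous_const) 0 t)]
  rw [phase_zero, one_mul]

theorem IsDiagonal.isSchrodingerGroup {e : HilbertBasis ι ℂ E} {l : ι → ℝ} {H : E →ₗ.[ℂ] E}
    (h : IsDiagonal e l H) {ħ : ℝ} (hħ : ħ ≠ 0) :
    IsSchrodingerGroup ħ H (diagonalGroup ħ e l) where
  map_zero := diagonalGroup_zero ħ e l
  map_add := diagonalGroup_add ħ e l
  continuous := continuous_diagonalGroup ħ e l
  generator ψ φ := by
    constructor
    · intro hψ
      have hc := continuous_diagonalGroup ħ e l ((-(Complex.I / (ħ : ℂ))) • φ)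
      have h1 := intervalIntegral.integral_hasDerivAt_right (hc.intervalIntegrable (μ := volume) 0 0)
        hc.stronglyMeasurable.stronglyMeasurableAtFilter hc.continuousAt
      rw [hasDerivAt_iff_tendsto_slope_zero] at h1
      simp only [zero_add, intervalIntegral.integral_same, sub_zero, ← h.diagonalGroup_sub ħ hψ,
        diagonalGroup_zero] at h1
      refine h1.congr fun t => ?_
      rw [← Complex.ofReal_inv, Complex.coe_smul]
    · intro hψ
      rw [h]
      intro i
      have h1 := ((innerSL ℂ (e i)).continuous.tendsto _).comp hψ
      simp only [Function.comp_def, innerSL_apply_apply, inner_smul_right, inner_sub_right,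
        inner_diagonalGroup] at h1
      have h2 := (hasDerivAt_iff_tendsto_slope_zero.mp
        ((hasDerivAt_phase ħ (l i) 0).mul_const ⟪e i, ψ⟫_ℂ))
      simp only [zero_add, phase_zero, one_mul, mul_one] at h2
      have h3 := tendsto_nhds_unique h1 (h2.congr fun t => by
        rw [← Complex.coe_smul, Complex.ofReal_inv, smul_eq_mul])
      have hI : -(Complex.I / (ħ : ℂ)) ≠ 0 :=
        neg_ne_zero.mpr (div_ne_zero Complex.I_ne_zero (Complex.ofReal_ne_zero.mpr hħ))
      rw [mul_assoc] at h3
      exact mul_left_cancel₀ hI h3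

end Diagonal

/-! ### Schrödinger groups and the interaction picture -/

section Interaction

variable {ι E : Type*} [NormedAddCommGroup E] [InnerProductSpace ℂ E] [CompleteSpace E]

namespace IsSchrodingerGroup

variable {ħ : ℝ} {H : E →ₗ.[ℂ] E} {U : ℝ → unitary (E →L[ℂ] E)}

theorem map_neg (hU : IsSchrodingerGroup ħ H U) (t : ℝ) : U (-t) = star (U t) := by
  rw [Unitary.star_eq_inv]
  refine eq_inv_of_mul_eq_one_left ?_
  rw [← hU.map_add, neg_add_cancel, hU.map_zero]

theorem neg_apply_apply (hU : IsSchrodingerGroup ħ H U) (t : ℝ) (x : E) :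
    (U (-t) : E →L[ℂ] E) ((U t : E →L[ℂ] E) x) = x := by
  rw [← ContinuousLinearMap.comp_apply, ← ContinuousLinearMap.mul_def, ← Submonoid.coe_mul,
    ← hU.map_add, neg_add_cancel, hU.map_zero]
  rfl

theorem apply_neg_apply (hU : IsSchrodingerGroup ħ H U) (t : ℝ) (x : E) :
    (U t : E →L[ℂ] E) ((U (-t) : E →L[ℂ] E) x) = x := by
  simpa using hU.neg_apply_apply (-t) x

theorem inner_neg_apply (hU : IsSchrodingerGroup ħ H U) (t : ℝ) (x y : E) :
    ⟪(U (-t) : E →L[ℂ] E) x, y⟫_ℂ = ⟪x, (U t : E →L[ℂ] E) y⟫_ℂ := by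
  rw [hU.map_neg, Unitary.coe_star, ContinuousLinearMap.star_eq_adjoint,
    ContinuousLinearMap.adjoint_inner_left]

theorem hasDerivAt (hU : IsSchrodingerGroup ħ H U) {ψ φ : E} (h : (ψ, φ) ∈ H.graph) (t : ℝ) :
    HasDerivAt (fun t => (U t : E →L[ℂ] E) ψ)
      ((U t : E →L[ℂ] E) ((-(Complex.I / (ħ : ℂ))) • φ)) t := by
  rw [hasDerivAt_iff_tendsto_slope_zero]
  refine (((U t : E →L[ℂ] E).continuous.tendsto _).comp ((hU.generator ψ φ).mp h)).congr fun s => ?_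
  rw [hU.map_add, Function.comp_apply, map_smul, map_sub, ← Complex.ofReal_inv, Complex.coe_smul]
  rfl

/-- Strong continuity and isometry combine: replacing `x s` by `x s₀` costs exactly `‖x s - x s₀‖`,
whatever the time. -/
theorem continuous_comp (hU : IsSchrodingerGroup ħ H U) {X : Type*} [TopologicalSpace X]
    {f : X → ℝ} {x : X → E} (hf : Continuous f) (hx : Continuous x) :
    Continuous fun s => (U (f s) : E →L[ℂ] E) (x s) := by
  rw [continuous_iff_continuousAt]
  intro s₀
  have h1 : Continuous fun s => (U (f s) : E →L[ℂ] E) (x s₀) := (hU.continuous (x s₀)).comp hf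
  have h2 : Filter.Tendsto (fun s => (U (f s) : E →L[ℂ] E) (x s - x s₀)) (nhds s₀) (nhds 0) := by
    rw [tendsto_zero_iff_norm_tendsto_zero]
    simp only [norm_unitary_apply]
    rw [← tendsto_zero_iff_norm_tendsto_zero]
    have := (hx.tendsto s₀).sub_const (x s₀)
    rwa [sub_self] at this
  have h3 := h2.add (h1.tendsto s₀)
  rw [zero_add] at h3
  refine h3.congr fun s => ?_
  rw [← _root_.map_add, sub_add_cancel]

end IsSchrodingerGroup

variable {ħ : ℝ} {H H₀ : E →ₗ.[ℂ] E} {U : ℝ → unitary (E →L[ℂ] E)}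

theorem continuous_conj (hH₀ : IsSchrodingerGroup ħ H₀ U) {U' : ℝ → unitary (E →L[ℂ] E)}
    (hU' : IsSchrodingerGroup ħ H U') (B : E →L[ℂ] E) (ψ : E) :
    Continuous fun s => (U (-s) : E →L[ℂ] E) (B ((U' s : E →L[ℂ] E) ψ)) :=
  hH₀.continuous_comp continuous_neg (B.continuous.comp (hU'.continuous ψ))

/-- Duhamel's formula, valid for every `ψ`. Only matrix elements against `e i` are differentiated,
so `U s` can be moved onto `e i`, which lies in the domain of `H`; the phases then cancel the `l i`
term and leave `B`. -/
theorem diagonalGroup_neg_apply_sub {e : HilbertBasis ι ℂ E} {l : ι → ℝ}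
    (hU₀ : IsSchrodingerGroup ħ H₀ (diagonalGroup ħ e l)) (hU : IsSchrodingerGroup ħ H U)
    {B : E →L[ℂ] E} (hB : IsSelfAdjoint B)
    (h : ∀ i, (e i, (l i : ℂ) • e i + B (e i)) ∈ H.graph) (t : ℝ) (ψ : E) :
    (diagonalGroup ħ e l (-t) : E →L[ℂ] E) ((U t : E →L[ℂ] E) ψ) - ψ =
      (-(Complex.I / (ħ : ℂ))) • ∫ s in (0 : ℝ)..t,
        (diagonalGroup ħ e l (-s) : E →L[ℂ] E) (B ((U s : E →L[ℂ] E) ψ)) := by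
  refine HilbertBasis.ext_inner e fun i => ?_
  have hc := continuous_conj hU₀ hU B ψ
  have h1 := (innerSL ℂ (e i)).intervalIntegral_comp_comm
    (hc.intervalIntegrable (μ := volume) 0 t)
  simp only [innerSL_apply_apply] at h1
  have hc' : Continuous fun s => ⟪e i,
      (diagonalGroup ħ e l (-s) : E →L[ℂ] E) (B ((U s : E →L[ℂ] E) ψ))⟫_ℂ :=
    (innerSL ℂ (e i)).continuous.comp hc
  rw [inner_smul_right, ← h1, inner_sub_right, ← intervalIntegral.integral_const_mul]
  have h2 : ∀ s, HasDerivAt (fun s => ⟪e i, (U s : E →L[ℂ] E) ψ⟫_ℂ)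
      (-(Complex.I / (ħ : ℂ)) * (l i * ⟪e i, (U s : E →L[ℂ] E) ψ⟫_ℂ +
        ⟪e i, B ((U s : E →L[ℂ] E) ψ)⟫_ℂ)) s := fun s => by
    have h3 : HasDerivAt (fun s : ℝ => (U (-s) : E →L[ℂ] E) (e i)) _ s :=
      (hU.hasDerivAt (h i) (-s)).scomp s (hasDerivAt_neg s)
    have h4 := h3.inner ℂ (hasDerivAt_const s ψ)
    simp only [hU.inner_neg_apply] at h4
    refine h4.congr_deriv ?_
    rw [map_zero, inner_zero_right, zero_add, neg_one_smul, inner_neg_left, hU.inner_neg_apply,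
      inner_smul_left, inner_add_left, inner_smul_left, Complex.conj_ofReal,
      ← ContinuousLinearMap.adjoint_inner_right, ← ContinuousLinearMap.star_eq_adjoint, hB.star_eq]
    simp only [map_neg, map_div₀, Complex.conj_I, Complex.conj_ofReal]
    ring
  have h5 : ∀ s ∈ Set.uIcc 0 t, HasDerivAt
      (fun s => ⟪e i, (diagonalGroup ħ e l (-s) : E →L[ℂ] E) ((U s : E →L[ℂ] E) ψ)⟫_ℂ)
      (-(Complex.I / (ħ : ℂ)) * ⟪e i,
        (diagonalGroup ħ e l (-s) : E →L[ℂ] E) (B ((U s : E →L[ℂ] E) ψ))⟫_ℂ) s := fun s _ => by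
    have h6 : HasDerivAt (fun s : ℝ => phase ħ (l i) (-s)) _ s :=
      (hasDerivAt_phase ħ (l i) (-s)).scomp s (hasDerivAt_neg s)
    simp only [inner_diagonalGroup]
    refine (h6.mul (h2 s)).congr_deriv ?_
    rw [neg_one_smul]
    ring
  rw [intervalIntegral.integral_eq_sub_of_hasDerivAt h5
    ((continuous_const.mul hc').intervalIntegrable _ _)]
  rw [neg_zero, diagonalGroup_zero, hU.map_zero]
  rfl

theorem IsDiagonal.unique_group {e : HilbertBasis ι ℂ E} {l : ι → ℝ} (h : IsDiagonal e l H)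
    (hħ : ħ ≠ 0) (hU : IsSchrodingerGroup ħ H U) : U = diagonalGroup ħ e l := by
  have h0 := h.isSchrodingerGroup hħ
  funext t
  ext ψ
  have h1 := diagonalGroup_neg_apply_sub h0 hU (B := 0) (IsSelfAdjoint.zero _)
    (fun i => by simpa using h.basis_mem i) t ψ
  simp only [_root_.zero_apply, map_zero, intervalIntegral.integral_zero, smul_zero] at h1
  rw [← h0.apply_neg_apply t ((U t : E →L[ℂ] E) ψ), sub_eq_zero.mp h1]

theorem IsDiagonal.existsUnique_group {e : HilbertBasis ι ℂ E} {l : ι → ℝ} (h : IsDiagonal e l H)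
    (hħ : ħ ≠ 0) : ∃! U : ℝ → unitary (E →L[ℂ] E), IsSchrodingerGroup ħ H U :=
  ⟨_, h.isSchrodingerGroup hħ, fun _ hU => h.unique_group hħ hU⟩

/-- The strong integral `∫₀^δ U(s)* B U(s) ds`. -/
def conjIntegral (hU : IsSchrodingerGroup ħ H U) (B : E →L[ℂ] E) (δ : ℝ) : E →L[ℂ] E :=
  LinearMap.mkContinuous
    { toFun := fun ψ => ∫ s in (0 : ℝ)..δ, (U (-s) : E →L[ℂ] E) (B ((U s : E →L[ℂ] E) ψ))
      map_add' := fun ψ φ => by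
        simp only [map_add]
        exact intervalIntegral.integral_add
          ((continuous_conj hU hU B ψ).intervalIntegrable _ _)
          ((continuous_conj hU hU B φ).intervalIntegrable _ _)
      map_smul' := fun c ψ => by
        simp only [map_smul]
        exact intervalIntegral.integral_smul _ _ }
    (‖B‖ * |δ|) fun ψ => by
      have h := intervalIntegral.norm_integral_le_of_norm_le_const (a := 0) (b := δ)
        (C := ‖B‖ * ‖ψ‖) (f := fun s => (U (-s) : E →L[ℂ] E) (B ((U s : E →L[ℂ] E) ψ)))
        fun s _ => by
          rw [norm_unitary_apply, ← norm_unitary_apply (U s) ψ]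
          exact B.le_opNorm _
      rw [sub_zero] at h
      calc _ ≤ ‖B‖ * ‖ψ‖ * |δ| := h
        _ = _ := by ring

theorem conjIntegral_apply (hU : IsSchrodingerGroup ħ H U) (B : E →L[ℂ] E) (δ : ℝ) (ψ : E) :
    conjIntegral hU B δ ψ =
      ∫ s in (0 : ℝ)..δ, (U (-s) : E →L[ℂ] E) (B ((U s : E →L[ℂ] E) ψ)) := rfl

theorem norm_conjIntegral_le (hU : IsSchrodingerGroup ħ H U) (B : E →L[ℂ] E) (δ : ℝ) :
    ‖conjIntegral hU B δ‖ ≤ ‖B‖ * |δ| :=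
  LinearMap.mkContinuous_norm_le _ (by positivity) _

theorem conjIntegral_add (hU : IsSchrodingerGroup ħ H U) (B C : E →L[ℂ] E) (δ : ℝ) :
    conjIntegral hU (B + C) δ = conjIntegral hU B δ + conjIntegral hU C δ := by
  ext ψ
  rw [_root_.add_apply, conjIntegral_apply, conjIntegral_apply, conjIntegral_apply,
    ← intervalIntegral.integral_add ((continuous_conj hU hU B ψ).intervalIntegrable _ _)
      ((continuous_conj hU hU C ψ).intervalIntegrable _ _)]
  simp only [_root_.add_apply, map_add]

theorem conjIntegral_smul (hU : IsSchrodingerGroup ħ H U) (c : ℂ) (B : E →L[ℂ] E) (δ : ℝ) :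
    conjIntegral hU (c • B) δ = c • conjIntegral hU B δ := by
  ext ψ
  rw [_root_.smul_apply, conjIntegral_apply, conjIntegral_apply,
    ← intervalIntegral.integral_smul]
  simp only [_root_.smul_apply, map_smul]

/-- First-order expansion of the propagator in the perturbation `B`, in operator norm. -/
theorem norm_sub_mul_conjIntegral_le {e : HilbertBasis ι ℂ E} {l : ι → ℝ}
    (hU₀ : IsSchrodingerGroup ħ H₀ (diagonalGroup ħ e l)) (hU : IsSchrodingerGroup ħ H U)
    (hħ : 0 < ħ) {B : E →L[ℂ] E} (hB : IsSelfAdjoint B)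
    (h : ∀ i, (e i, (l i : ℂ) • e i + B (e i)) ∈ H.graph) (δ : ℝ) :
    ‖(U δ : E →L[ℂ] E) - diagonalGroup ħ e l δ *
      (1 - (Complex.I / (ħ : ℂ)) • conjIntegral hU₀ B δ)‖ ≤ (‖B‖ / ħ) ^ 2 * δ ^ 2 := by
  have hn : ‖-(Complex.I / (ħ : ℂ))‖ = ħ⁻¹ := by
    rw [norm_neg, norm_div, Complex.norm_I, Complex.norm_real, Real.norm_of_nonneg hħ.le, one_div]
  have hI := diagonalGroup_neg_apply_sub hU₀ hU hB h
  have h1 : ∀ s ψ, ‖(U s : E →L[ℂ] E) ψ - (diagonalGroup ħ e l s : E →L[ℂ] E) ψ‖ ≤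
      ‖B‖ / ħ * ‖ψ‖ * |s| := fun s ψ => by
    rw [← norm_unitary_apply (diagonalGroup ħ e l (-s)), map_sub, hU₀.neg_apply_apply, hI,
      norm_smul, hn]
    have h2 := intervalIntegral.norm_integral_le_of_norm_le_const (a := 0) (b := s)
      (C := ‖B‖ * ‖ψ‖)
      (f := fun s => (diagonalGroup ħ e l (-s) : E →L[ℂ] E) (B ((U s : E →L[ℂ] E) ψ)))
      fun s _ => by
        rw [norm_unitary_apply, ← norm_unitary_apply (U s) ψ]
        exact B.le_opNorm _
    rw [sub_zero] at h2
    calc _ ≤ ħ⁻¹ * (‖B‖ * ‖ψ‖ * |s|) := by gcongr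
      _ = _ := by ring
  refine ContinuousLinearMap.opNorm_le_bound _ (by positivity) fun ψ => ?_
  rw [← norm_unitary_apply (diagonalGroup ħ e l (-δ)), _root_.sub_apply, map_sub,
    ContinuousLinearMap.mul_def, ContinuousLinearMap.comp_apply, hU₀.neg_apply_apply,
    _root_.sub_apply, _root_.smul_apply, show (1 : E →L[ℂ] E) ψ = ψ from rfl, conjIntegral_apply]
  have h3 : (diagonalGroup ħ e l (-δ) : E →L[ℂ] E) ((U δ : E →L[ℂ] E) ψ) -
      (ψ - (Complex.I / (ħ : ℂ)) • ∫ s in (0 : ℝ)..δ, (diagonalGroup ħ e l (-s) : E →L[ℂ] E)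
        (B ((diagonalGroup ħ e l s : E →L[ℂ] E) ψ))) =
      (-(Complex.I / (ħ : ℂ))) • ∫ s in (0 : ℝ)..δ, (diagonalGroup ħ e l (-s) : E →L[ℂ] E)
        (B ((U s : E →L[ℂ] E) ψ - (diagonalGroup ħ e l s : E →L[ℂ] E) ψ)) := by
    simp only [map_sub]
    rw [intervalIntegral.integral_sub ((continuous_conj hU₀ hU B ψ).intervalIntegrable _ _)
      ((continuous_conj hU₀ hU₀ B ψ).intervalIntegrable _ _), smul_sub, ← hI]
    rw [neg_smul]
    abel
  rw [h3, norm_smul, hn]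
  have h4 := intervalIntegral.norm_integral_le_of_norm_le_const (a := 0) (b := δ)
    (C := ‖B‖ * (‖B‖ / ħ * ‖ψ‖ * |δ|))
    (f := fun s => (diagonalGroup ħ e l (-s) : E →L[ℂ] E)
        (B ((U s : E →L[ℂ] E) ψ - (diagonalGroup ħ e l s : E →L[ℂ] E) ψ)))
    fun s hs => by
      rw [norm_unitary_apply]
      refine (B.le_opNorm _).trans ?_
      have hs' : |s| ≤ |δ| := by
        have := Set.abs_sub_left_of_mem_uIcc (Set.uIoc_subset_uIcc hs)
        simpa using this
      refine mul_le_mul_of_nonneg_left ((h1 s ψ).trans ?_) (norm_nonneg _)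
      gcongr
  rw [sub_zero] at h4
  calc _ ≤ ħ⁻¹ * (‖B‖ * (‖B‖ / ħ * ‖ψ‖ * |δ|) * |δ|) := by gcongr
    _ = (‖B‖ / ħ) ^ 2 * |δ| ^ 2 * ‖ψ‖ := by ring
    _ = _ := by rw [sq_abs]

end Interaction

/-! ### Perturbations of an operator with compact resolvent -/

section Perturbation

universe u

variable {ι : Type*} {E : Type u} [NormedAddCommGroup E] [InnerProductSpace ℂ E] [CompleteSpace E]

/-- Telescoping: each of the `k` factors contributes one error `ε`, with `‖a‖ ≤ 1` on one side and
`‖b‖ ≤ 1 + ε` on the other. -/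
theorem norm_pow_sub_pow_le {R : Type*} [NormedRing R] [NormOneClass R] {a b : R} {ε : ℝ}
    (ha : ‖a‖ ≤ 1) (hab : ‖a - b‖ ≤ ε) (k : ℕ) : ‖a ^ k - b ^ k‖ ≤ k * ε * (1 + ε) ^ k := by
  have hε : 0 ≤ ε := (norm_nonneg _).trans hab
  have hb : ‖b‖ ≤ 1 + ε := by
    calc ‖b‖ = ‖a - (a - b)‖ := by rw [sub_sub_cancel]
      _ ≤ ‖a‖ + ‖a - b‖ := norm_sub_le _ _
      _ ≤ 1 + ε := add_le_add ha hab
  induction k with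
  | zero => simp
  | succ k ih =>
    have h1 : a ^ (k + 1) - b ^ (k + 1) = a * (a ^ k - b ^ k) + (a - b) * b ^ k := by
      rw [pow_succ', pow_succ']
      noncomm_ring
    have h2 : ‖b ^ k‖ ≤ (1 + ε) ^ k :=
      (norm_pow_le _ _).trans (pow_le_pow_left₀ (norm_nonneg _) hb k)
    calc ‖a ^ (k + 1) - b ^ (k + 1)‖ ≤ ‖a * (a ^ k - b ^ k)‖ + ‖(a - b) * b ^ k‖ := by
          rw [h1]; exact norm_add_le _ _
      _ ≤ ‖a‖ * ‖a ^ k - b ^ k‖ + ‖a - b‖ * ‖b ^ k‖ :=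
          add_le_add (norm_mul_le _ _) (norm_mul_le _ _)
      _ ≤ 1 * (k * ε * (1 + ε) ^ k) + ε * (1 + ε) ^ k := by gcongr
      _ = (k + 1) * ε * (1 + ε) ^ k := by ring
      _ ≤ (k + 1) * ε * (1 + ε) ^ (k + 1) := by
          refine mul_le_mul_of_nonneg_left ?_ (by positivity)
          exact pow_le_pow_right₀ (by linarith) (Nat.le_succ k)
      _ = _ := by push_cast; ring

/-- The accumulated error of `N` steps with local error `c / N²`: the power stays below `exp c`, and
the prefactor is `c / N`. -/
theorem tendsto_mul_one_add_div_sq_pow (c : ℝ) (hc : 0 ≤ c) :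
    Filter.Tendsto (fun N : ℕ => (N : ℝ) * (c / N ^ 2) * (1 + c / N ^ 2) ^ N) Filter.atTop
      (nhds 0) := by
  have h1 : Filter.Tendsto (fun N : ℕ => c / N * Real.exp c) Filter.atTop (nhds 0) := by
    have := (tendsto_const_div_atTop_nhds_zero_nat c).mul_const (Real.exp c)
    rwa [zero_mul] at this
  refine squeeze_zero' (Filter.Eventually.of_forall fun N => by positivity) ?_ h1
  filter_upwards [Filter.eventually_ge_atTop 1] with N hN
  have hN' : (1 : ℝ) ≤ N := by exact_mod_cast hN
  have h2 : (N : ℝ) * (c / N ^ 2) = c / N := by field_simp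
  have h3 : (1 + c / N ^ 2) ^ N ≤ Real.exp c := by
    calc (1 + c / (N : ℝ) ^ 2) ^ N ≤ Real.exp (c / N ^ 2) ^ N := by
          refine pow_le_pow_left₀ (by positivity) ?_ N
          rw [add_comm]
          exact Real.add_one_le_exp _
      _ = Real.exp (c / N) := by rw [← Real.exp_nat_mul, h2]
      _ ≤ Real.exp c := Real.exp_le_exp.mpr (div_le_self hc hN')
  rw [h2]
  exact mul_le_mul_of_nonneg_left h3 (by positivity)

variable {ħ : ℝ} {H H₀ : E →ₗ.[ℂ] E} {U : ℝ → unitary (E →L[ℂ] E)}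

/-- A closed algebra that contains `1`, is invariant under the free evolution and contains the
integrals `∫₀^δ U₀(s)* B U₀(s) ds` contains the propagator of the interaction picture. -/
theorem neg_mul_mem_of_conjIntegral_mem [Nontrivial E] {e : HilbertBasis ι ℂ E} {l : ι → ℝ}
    (hU₀ : IsSchrodingerGroup ħ H₀ (diagonalGroup ħ e l)) (hU : IsSchrodingerGroup ħ H U)
    (hħ : 0 < ħ) {B : E →L[ℂ] E} (hB : IsSelfAdjoint B)
    (h : ∀ i, (e i, (l i : ℂ) • e i + B (e i)) ∈ H.graph)
    (A : NonUnitalStarSubalgebra ℂ (E →L[ℂ] E)) (hA : IsClosed (A : Set (E →L[ℂ] E)))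
    (h1 : 1 ∈ A)
    (hτ : ∀ t, ∀ O ∈ A,
      (diagonalGroup ħ e l (-t) : E →L[ℂ] E) * O * (diagonalGroup ħ e l t : E →L[ℂ] E) ∈ A)
    (hK : ∀ δ, conjIntegral hU₀ B δ ∈ A) (T : ℝ) :
    (diagonalGroup ħ e l (-T) : E →L[ℂ] E) * (U T : E →L[ℂ] E) ∈ A := by
  set U₀ := diagonalGroup ħ e l with hU₀'
  have hadd : ∀ s t, (U₀ (s + t) : E →L[ℂ] E) = (U₀ s : E →L[ℂ] E) * (U₀ t : E →L[ℂ] E) :=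
    fun s t => by rw [hU₀.map_add, Submonoid.coe_mul]
  have hcancel : ∀ t, (U₀ t : E →L[ℂ] E) * (U₀ (-t) : E →L[ℂ] E) = 1 := fun t => by
    rw [← hadd, add_neg_cancel, hU₀.map_zero]; rfl
  have hcancel' : ∀ t, (U₀ (-t) : E →L[ℂ] E) * (U₀ t : E →L[ℂ] E) = 1 := fun t => by
    rw [← hadd, neg_add_cancel, hU₀.map_zero]; rfl
  have hpow : ∀ (δ : ℝ) (k : ℕ), (U (k * δ) : E →L[ℂ] E) = (U δ : E →L[ℂ] E) ^ k := by
    intro δ k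
    induction k with
    | zero => rw [Nat.cast_zero, zero_mul, hU.map_zero, pow_zero]; rfl
    | succ k ih =>
      rw [Nat.cast_succ, add_mul, one_mul, hU.map_add, Submonoid.coe_mul, ih, pow_succ]
  -- Induction step: the next element is the free conjugate, over time `δ`, of the previous one,
  -- multiplied on the right by `X`. Thus `U₀ δ` itself never has to lie in `A`.
  have hmem : ∀ (δ : ℝ) (X : E →L[ℂ] E), X ∈ A → ∀ k : ℕ,
      (U₀ (-(k * δ)) : E →L[ℂ] E) * ((U₀ δ : E →L[ℂ] E) * X) ^ k ∈ A := by
    intro δ X hX k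
    induction k with
    | zero => rw [Nat.cast_zero, zero_mul, neg_zero, hU₀.map_zero, pow_zero]; simpa using h1
    | succ k ih =>
      have := mul_mem (hτ δ _ ih) hX
      rw [Nat.cast_succ, add_mul, one_mul, neg_add_rev, hadd, pow_succ]
      simpa only [mul_assoc] using this
  let X : ℝ → (E →L[ℂ] E) := fun δ => 1 - (Complex.I / (ħ : ℂ)) • conjIntegral hU₀ B δ
  have hX : ∀ δ, X δ ∈ A := fun δ => sub_mem h1 (SMulMemClass.smul_mem _ (hK δ))
  have hbound : ∀ N : ℕ, 1 ≤ N →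
      ‖(U T : E →L[ℂ] E) - ((U₀ (T / N) : E →L[ℂ] E) * X (T / N)) ^ N‖ ≤
      N * (((‖B‖ / ħ) ^ 2 * T ^ 2) / N ^ 2) * (1 + ((‖B‖ / ħ) ^ 2 * T ^ 2) / N ^ 2) ^ N := by
    intro N hN
    have hN0 : (N : ℝ) ≠ 0 := by positivity
    have h2 := norm_sub_mul_conjIntegral_le hU₀ hU hħ hB h (T / N)
    rw [div_pow T, ← mul_div_assoc] at h2
    have h3 := norm_pow_sub_pow_le (CStarRing.norm_of_mem_unitary (U (T / N)).2).le h2 N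
    rwa [← hpow, mul_div_cancel₀ T hN0] at h3
  have hlim : Filter.Tendsto (fun N : ℕ => (U₀ (-T) : E →L[ℂ] E) *
      ((U₀ (T / N) : E →L[ℂ] E) * X (T / N)) ^ N) Filter.atTop
      (nhds ((U₀ (-T) : E →L[ℂ] E) * (U T : E →L[ℂ] E))) := by
    refine Filter.Tendsto.const_mul _ ?_
    rw [tendsto_iff_norm_sub_tendsto_zero]
    refine squeeze_zero' (Filter.Eventually.of_forall fun N => norm_nonneg _) ?_
      (tendsto_mul_one_add_div_sq_pow ((‖B‖ / ħ) ^ 2 * T ^ 2) (by positivity))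
    filter_upwards [Filter.eventually_ge_atTop 1] with N hN
    rw [norm_sub_rev]
    exact hbound N hN
  refine hA.mem_of_tendsto hlim ?_
  filter_upwards [Filter.eventually_ge_atTop 1] with N hN
  have hN0 : (N : ℝ) ≠ 0 := by positivity
  have := hmem (T / N) (X (T / N)) (hX _) N
  rwa [mul_div_cancel₀ T hN0] at this

/-- The finite-rank truncations converge in operator norm, since the remainder is diagonal with
entries that are uniformly small off a finite set. -/
theorem isCompactOperator_of_diagonal (e : HilbertBasis ι ℂ E) {D : E →L[ℂ] E} {m : ι → ℂ}
    (hD : ∀ i, D (e i) = m i • e i) (hm : Filter.Tendsto m Filter.cofinite (nhds 0)) :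
    IsCompactOperator D := by
  classical
  let P : ι → (E →L[ℂ] E) := fun i =>
    m i • (ContinuousLinearMap.toSpanSingleton ℂ (e i)).comp (innerSL ℂ (e i))
  have hP : ∀ i, P i ∈ compactOperator (RingHom.id ℂ) E E := fun i =>
    Submodule.smul_mem _ _ ((isCompactOperator_of_locallyCompactSpace_rng
      (ContinuousLinearMap.toSpanSingleton ℂ (e i))).comp_clm (innerSL ℂ (e i)))
  have hPi : ∀ i j x, ⟪e j, P i x⟫_ℂ = if j = i then m j * ⟪e j, x⟫_ℂ else 0 := by
    intro i j x
    have h1 := orthonormal_iff_ite.mp e.orthonormal j i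
    simp only [P, _root_.smul_apply, ContinuousLinearMap.comp_apply, innerSL_apply_apply,
      ContinuousLinearMap.toSpanSingleton_apply, inner_smul_right, h1]
    by_cases hij : j = i
    · subst hij; simp
    · simp [hij]
  have hlim : Filter.Tendsto (fun F : Finset ι => ∑ i ∈ F, P i) Filter.atTop (nhds D) := by
    rw [Metric.tendsto_atTop]
    intro ε hε
    have hfin : {i | ¬ ‖m i‖ < ε / 2}.Finite := by
      have := hm (Metric.ball_mem_nhds 0 (half_pos hε))
      have h2 := Filter.mem_cofinite.mp this
      convert h2 using 1
      ext i
      simp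
    refine ⟨hfin.toFinset, fun F hF => ?_⟩
    rw [dist_eq_norm]
    refine lt_of_le_of_lt ?_ (half_lt_self hε)
    refine ContinuousLinearMap.opNorm_le_bound _ (half_pos hε).le fun x => ?_
    have h3 : ‖(∑ i ∈ F, P i - D) x‖ ≤ ‖((ε / 2 : ℝ) : ℂ) • x‖ := by
      refine norm_le_of_inner_le e fun j => ?_
      rw [_root_.sub_apply, inner_sub_right, _root_.sum_apply, inner_sum,
        HilbertBasis.inner_apply_of_diagonal e hD, inner_smul_right, norm_mul, Complex.norm_real,
        Real.norm_of_nonneg (half_pos hε).le]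
      simp only [hPi, Finset.sum_ite_eq]
      by_cases hj : j ∈ F
      · rw [if_pos hj, sub_self, norm_zero]; positivity
      · rw [if_neg hj, zero_sub, norm_neg, norm_mul]
        refine mul_le_mul_of_nonneg_right ?_ (norm_nonneg _)
        by_contra hlt
        exact hj (hF (hfin.mem_toFinset.mpr fun h => hlt h.le))
    rwa [norm_smul, Complex.norm_real, Real.norm_of_nonneg (half_pos hε).le] at h3
  exact isCompactOperator_of_tendsto hlim
    (Filter.Eventually.of_forall fun F => Submodule.sum_mem _ fun i _ => hP i)

/-- The spectral theorem for compact self-adjoint operators. -/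
theorem exists_eigenbasis {F : Type u} [NormedAddCommGroup F] [InnerProductSpace ℂ F]
    [CompleteSpace F] {T : F →L[ℂ] F} (hT : IsCompactOperator T) (hsa : IsSelfAdjoint T) :
    ∃ (κ : Type u) (f : HilbertBasis κ ℂ F) (μ : κ → ℝ), ∀ k, T (f k) = (μ k : ℂ) • f k := by
  have hsym : (T : F →ₗ[ℂ] F).IsSymmetric := hsa.isSymmetric
  let G : ℂ → Submodule ℂ F := fun μ => Module.End.eigenspace (T : Module.End ℂ F) μ
  have hmemG : ∀ μ x, x ∈ G μ ↔ T x = μ • x := fun μ x => Module.End.mem_eigenspace_iff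
  have hcl : ∀ μ, IsClosed (G μ : Set F) := fun μ => by
    have : (G μ : Set F) = {x | T x = μ • x} := Set.ext fun x => hmemG μ x
    rw [this]
    exact isClosed_eq T.continuous (continuous_const_smul μ)
  have : ∀ μ, CompleteSpace (G μ) := fun μ => (hcl μ).completeSpace_coe
  -- One Hilbert basis per complex number; eigenspaces at non-eigenvalues are zero and contribute no
  -- vector.
  choose w b hb using fun μ => exists_hilbertBasis ℂ (G μ)
  have hon := hsym.orthogonalFamily_eigenspaces.orthonormal_sigma_orthonormal
    (v_family := fun μ => b μ) fun μ => (b μ).orthonormal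
  let v : (Σ μ, w μ) → F := fun k => (b k.1 k.2 : F)
  -- A vector orthogonal to every chosen basis is orthogonal to every eigenspace, and for a compact
  -- symmetric operator only zero is.
  have hbot : (Submodule.span ℂ (Set.range v))ᗮ = ⊥ := by
    rw [eq_bot_iff, ← ContinuousLinearMap.orthogonalComplement_iSup_eigenspaces_eq_bot hT hsym]
    intro x hx
    rw [Submodule.mem_orthogonal] at hx
    rw [← Submodule.iInf_orthogonal, Submodule.mem_iInf]
    intro μ
    rw [Submodule.mem_orthogonal']
    intro y hy
    have h0 : (innerSL ℂ x).comp (G μ).subtypeL = 0 := by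
      refine HilbertBasis.clm_ext (b μ) fun k => ?_
      have := hx (v ⟨μ, k⟩) (Submodule.subset_span ⟨_, rfl⟩)
      rw [inner_eq_zero_symm] at this
      exact this
    exact congrArg (fun S : G μ →L[ℂ] ℂ => S ⟨y, hy⟩) h0
  let f : HilbertBasis (Σ μ, w μ) ℂ F := HilbertBasis.mkOfOrthogonalEqBot hon hbot
  have hf : ⇑f = v := HilbertBasis.coe_mkOfOrthogonalEqBot hon hbot
  refine ⟨_, f, fun k => k.1.re, fun k => ?_⟩
  have h1 : T (f k) = k.1 • f k := by
    rw [hf]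
    exact (hmemG _ _).mp (b k.1 k.2).2
  have hne : f k ≠ 0 := f.orthonormal.ne_zero k
  have h2 := hsym.conj_eigenvalue_eq_self (Module.End.hasEigenvalue_of_hasEigenvector
    ⟨(hmemG _ _).mpr h1, hne⟩)
  rw [h1, Complex.conj_eq_iff_re.mp h2]

/-- A bounded self-adjoint perturbation of a nonnegative diagonal operator with discrete spectrum is
again diagonalizable. -/
theorem IsDiagonal.exists_isDiagonal_add {e : HilbertBasis ι ℂ E} {l : ι → ℝ}
    (h₀ : IsDiagonal e l H₀) (hl : ∀ i, 0 ≤ l i)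
    (hlim : Filter.Tendsto l Filter.cofinite Filter.atTop) {B : E →L[ℂ] E} (hB : IsSelfAdjoint B)
    (hH : ∀ ψ φ, (ψ, φ) ∈ H.graph ↔ (ψ, φ - B ψ) ∈ H₀.graph) :
    ∃ (κ : Type u) (f : HilbertBasis κ ℂ E) (μ : κ → ℝ), IsDiagonal f μ H := by
  -- The shift exceeds `‖B‖`, so that `R₀ = (H₀ + c)⁻¹`, of norm at most `1 / c`, satisfies `‖R₀ B‖
  -- < 1`.
  set c : ℝ := ‖B‖ + 1 with hc
  have hcpos : 0 < c := by positivity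
  have hpos : ∀ i, 0 < l i + c := fun i => add_pos_of_nonneg_of_pos (hl i) hcpos
  have hne : ∀ i, ((l i + c : ℝ) : ℂ) ≠ 0 := fun i => Complex.ofReal_ne_zero.mpr (hpos i).ne'
  let m : ι → ℂ := fun i => (((l i + c)⁻¹ : ℝ) : ℂ)
  have hm : ∀ i, ‖m i‖ ≤ c⁻¹ := fun i => by
    rw [Complex.norm_real, Real.norm_of_nonneg (inv_nonneg.mpr (hpos i).le)]
    exact inv_anti₀ hcpos (le_add_of_nonneg_left (hl i))
  set R₀ := diagonalOp e m with hR₀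
  have hR₀sa : star R₀ = R₀ := by
    rw [hR₀, star_diagonalOp e hm]
    congr 1
    funext i
    exact Complex.conj_ofReal _
  have hR₀c : IsCompactOperator R₀ := by
    refine isCompactOperator_of_diagonal e (diagonalOp_apply e hm) ?_
    have h1 : Filter.Tendsto (fun i => (l i + c)⁻¹) Filter.cofinite (nhds 0) :=
      tendsto_inv_atTop_zero.comp (Filter.tendsto_atTop_add_const_right _ c hlim)
    have h2 := (Complex.continuous_ofReal.tendsto 0).comp h1
    rwa [Complex.ofReal_zero] at h2
  have hgraph₀ : ∀ ψ φ, (ψ, φ) ∈ H₀.graph ↔ ψ = R₀ (φ + (c : ℂ) • ψ) := by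
    intro ψ φ
    rw [h₀]
    have key : ∀ i, (⟪e i, φ⟫_ℂ = l i * ⟪e i, ψ⟫_ℂ ↔
        ⟪e i, ψ⟫_ℂ = ⟪e i, R₀ (φ + (c : ℂ) • ψ)⟫_ℂ) := fun i => by
      have := hne i
      rw [inner_diagonalOp e hm, inner_add_right, inner_smul_right]
      simp only [m]
      rw [Complex.ofReal_inv, eq_inv_mul_iff_mul_eq₀ this]
      push_cast
      rw [add_mul, add_left_inj]
      exact eq_comm
    simp only [key]
    exact ⟨fun h => HilbertBasis.ext_inner e h, fun h i => by rw [← h]⟩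
  have hlt : ‖-(R₀ * B)‖ < 1 := by
    rw [norm_neg]
    calc ‖R₀ * B‖ ≤ ‖R₀‖ * ‖B‖ := norm_mul_le _ _
      _ ≤ c⁻¹ * ‖B‖ := by gcongr; exact norm_diagonalOp_le e (inv_nonneg.mpr hcpos.le) hm
      _ < 1 := by rw [inv_mul_lt_one₀ hcpos, hc]; exact lt_add_one _
  let u : (E →L[ℂ] E)ˣ := Units.oneSub (-(R₀ * B)) hlt
  have hu : (u : E →L[ℂ] E) = 1 + R₀ * B := by
    rw [Units.val_oneSub, sub_neg_eq_add]
  -- `R = (1 + R₀ B)⁻¹ R₀` is `(H + c)⁻¹`, since `H + c = (H₀ + c)(1 + R₀ B)`.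
  set R : E →L[ℂ] E := ((u⁻¹ : (E →L[ℂ] E)ˣ) : E →L[ℂ] E) * R₀ with hR
  have hRsa : IsSelfAdjoint R := by
    have h1 : (u : E →L[ℂ] E) * R₀ = R₀ * star (u : E →L[ℂ] E) := by
      rw [hu, star_add, star_mul, star_one, hB.star_eq, hR₀sa]
      noncomm_ring
    rw [isSelfAdjoint_iff, hR, star_mul, hR₀sa, Units.eq_inv_mul_iff_mul_eq, ← mul_assoc, h1,
      mul_assoc, ← star_mul, Units.inv_mul, star_one, mul_one]
  have hRc : IsCompactOperator R := hR₀c.clm_comp _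
  have huapp : ∀ x y, x = ((u⁻¹ : (E →L[ℂ] E)ˣ) : E →L[ℂ] E) y ↔ (u : E →L[ℂ] E) x = y := by
    intro x y
    constructor
    · rintro rfl
      rw [← ContinuousLinearMap.comp_apply, ← ContinuousLinearMap.mul_def, Units.mul_inv]
      rfl
    · rintro rfl
      rw [← ContinuousLinearMap.comp_apply, ← ContinuousLinearMap.mul_def, Units.inv_mul]
      rfl
  have hgraph : ∀ ψ φ, (ψ, φ) ∈ H.graph ↔ ψ = R (φ + (c : ℂ) • ψ) := by
    intro ψ φ
    rw [hH, hgraph₀, hR, ContinuousLinearMap.mul_def, ContinuousLinearMap.comp_apply, huapp, hu,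
      show (1 + R₀ * B) ψ = ψ + R₀ (B ψ) from rfl, show φ - B ψ + (c : ℂ) • ψ =
        (φ + (c : ℂ) • ψ) - B ψ by abel, map_sub, eq_sub_iff_add_eq]
  -- Injectivity excludes the eigenvalue `0` of `R`, so the numbers `μ⁻¹ - c` make sense as
  -- eigenvalues of `H`.
  have hRinj : ∀ x, R x = 0 → x = 0 := by
    intro x hx
    have h1 : R₀ x = 0 := by
      have := (huapp (R x) (R₀ x)).mp rfl
      rw [← this, hx, map_zero]
    refine HilbertBasis.ext_inner e fun i => ?_
    have h2 := inner_diagonalOp e hm i x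
    rw [← hR₀, h1, inner_zero_right] at h2
    have hmi : m i ≠ 0 := Complex.ofReal_ne_zero.mpr (inv_ne_zero (hpos i).ne')
    rw [inner_zero_right]
    exact (mul_eq_zero.mp h2.symm).resolve_left hmi
  obtain ⟨κ, f, μ, hf⟩ := exists_eigenbasis hRc hRsa
  have hμ : ∀ k, μ k ≠ 0 := fun k h0 => f.orthonormal.ne_zero k
    (hRinj _ (by rw [hf, h0, Complex.ofReal_zero, zero_smul]))
  refine ⟨κ, f, fun k => (μ k)⁻¹ - c, fun ψ φ => ?_⟩
  rw [hgraph]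
  have key : ∀ k, (⟪f k, ψ⟫_ℂ = ⟪f k, R (φ + (c : ℂ) • ψ)⟫_ℂ ↔
      ⟪f k, φ⟫_ℂ = (((μ k)⁻¹ - c : ℝ) : ℂ) * ⟪f k, ψ⟫_ℂ) := fun k => by
    have h1 : (μ k : ℂ) ≠ 0 := Complex.ofReal_ne_zero.mpr (hμ k)
    rw [HilbertBasis.inner_apply_of_diagonal f hf, inner_add_right, inner_smul_right,
      ← inv_mul_eq_iff_eq_mul₀ h1]
    push_cast
    rw [sub_mul, eq_sub_iff_add_eq]
    exact eq_comm
  simp only [← key]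
  exact ⟨fun h k => by rw [← h], fun h => HilbertBasis.ext_inner f h⟩

end Perturbation

/-! ### The free Hamiltonian is diagonal in the plane waves -/

section FreeHamiltonian

variable {n : ℕ}

theorem torusProj_add (x y : Momentum n) : torusProj n (x + y) = torusProj n x + torusProj n y := by
  funext j
  simp only [torusProj, PiLp.add_apply, AddCircle.coe_add, Pi.add_apply]

theorem continuous_torusProj : Continuous (torusProj n) :=
  (isOpenQuotientMap_torusProj n).continuous

theorem mFourier_torusProj (b : Fin n → ℤ) (x : Momentum n) :
    mFourier b (torusProj n x) =
      Complex.exp ((2 * Real.pi * ∑ j, (b j : ℝ) * x j : ℝ) * Complex.I) := by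
  simp only [mFourier, ContinuousMap.coe_mk, torusProj, fourier_coe_apply]
  rw [← Complex.exp_sum]
  congr 1
  push_cast
  rw [Finset.mul_sum, Finset.sum_mul]
  refine Finset.sum_congr rfl fun j _ => ?_
  ring

theorem mFourier_apply_add (b : Fin n → ℤ) (p q : Torus n) :
    mFourier b (p + q) = mFourier b p * mFourier b q := by
  simp only [mFourier, ContinuousMap.coe_mk, ← Finset.prod_mul_distrib]
  refine Finset.prod_congr rfl fun j _ => ?_
  simp [fourier_apply, AddCircle.toCircle_add]

theorem mFourier_mem_smoothFunctions (b : Fin n → ℤ) : mFourier b ∈ smoothFunctions n := by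
  have h : ContDiff ℝ ∞ fun x : Momentum n =>
      Complex.exp ((2 * Real.pi * ∑ j, (b j : ℝ) * x j : ℝ) * Complex.I) := by
    refine ContDiff.cexp (ContDiff.mul (Complex.ofRealCLM.contDiff.comp ?_) contDiff_const)
    refine contDiff_const.mul (ContDiff.sum fun j _ => contDiff_const.mul ?_)
    exact (EuclideanSpace.proj (𝕜 := ℝ) j).contDiff
  have h2 : (mFourier b : Torus n → ℂ) ∘ torusProj n = fun x : Momentum n =>
      Complex.exp ((2 * Real.pi * ∑ j, (b j : ℝ) * x j : ℝ) * Complex.I) :=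
    funext fun x => mFourier_torusProj b x
  change ContDiff ℝ ∞ ((mFourier b : Torus n → ℂ) ∘ torusProj n)
  rw [h2]
  exact h

theorem inner_planeWave_toL2 (b : Fin n → ℤ) (f : C(Torus n, ℂ)) :
    ⟪planeWave b, toL2 n f⟫_ℂ = ∫ q, mFourier (-b) q * f q ∂(torusMeasure n) := by
  rw [planeWave, ContinuousMap.inner_toLp]
  refine integral_congr_ae (Filter.Eventually.of_forall fun q => ?_)
  simp only [mFourier_neg]
  ring

/-- The directional derivative of a `C¹` function on the torus. -/
theorem exists_lineDeriv {f : C(Torus n, ℂ)} (hf : ContDiff ℝ 1 (f ∘ torusProj n))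
    (v : Momentum n) :
    ∃ g : C(Torus n, ℂ), ∀ x, g (torusProj n x) = fderiv ℝ (f ∘ torusProj n) x v := by
  have hcont : Continuous fun x => fderiv ℝ (f ∘ torusProj n) x v :=
    (hf.continuous_fderiv (by norm_num)).clm_apply continuous_const
  -- The derivative of a periodic function is periodic, so it descends to the torus.
  have hfac : Function.FactorsThrough (fun x => fderiv ℝ (f ∘ torusProj n) x v) (torusProj n) := by
    intro x y hxy
    have hper : ∀ z, (f ∘ torusProj n) (z + (y - x)) = (f ∘ torusProj n) z := by
      intro z
      have h1 : torusProj n (z + (y - x)) = torusProj n z := by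
        have h2 : torusProj n ((y - x) + x) = torusProj n (y - x) + torusProj n x :=
          torusProj_add _ _
        rw [sub_add_cancel, ← hxy, right_eq_add] at h2
        rw [torusProj_add, h2, add_zero]
      simp only [Function.comp_apply, h1]
    have h := fderiv_comp_add_right (𝕜 := ℝ) (f := f ∘ torusProj n) (x := x) (y - x)
    simp only [hper] at h
    rw [add_sub_cancel] at h
    change fderiv ℝ (f ∘ torusProj n) x v = fderiv ℝ (f ∘ torusProj n) y v
    rw [← h]
  refine ⟨(isOpenQuotientMap_torusProj n).isQuotientMap.lift
    (f := ⟨torusProj n, continuous_torusProj⟩) ⟨_, hcont⟩ hfac, fun x => ?_⟩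
  exact congrArg (fun F : C(Momentum n, ℂ) => F x)
    (Topology.IsQuotientMap.lift_comp (f := ⟨torusProj n, continuous_torusProj⟩)
      (isOpenQuotientMap_torusProj n).isQuotientMap ⟨_, hcont⟩ hfac)

/-- Integration by parts against a plane wave. -/
theorem integral_mFourier_mul_lineDeriv {f g : C(Torus n, ℂ)}
    (hf : ContDiff ℝ 1 (f ∘ torusProj n)) {v : Momentum n}
    (hg : ∀ x, g (torusProj n x) = fderiv ℝ (f ∘ torusProj n) x v) (b : Fin n → ℤ) :
    ∫ q, mFourier (-b) q * g q ∂(torusMeasure n) =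
      (2 * Real.pi * ∑ j, (b j : ℝ) * v j : ℝ) * Complex.I *
        ∫ q, mFourier (-b) q * f q ∂(torusMeasure n) := by
  have hline : ∀ (q : Torus n) (s : ℝ), HasDerivAt (fun s : ℝ => f (q + torusProj n (s • v)))
      (g (q + torusProj n (s • v))) s := by
    intro q s
    obtain ⟨x, rfl⟩ := (isOpenQuotientMap_torusProj n).surjective q
    simp only [← torusProj_add]
    rw [hg]
    have h1 : HasDerivAt (fun s : ℝ => x + s • v) v s := by
      simpa using ((hasDerivAt_id s).smul_const v).const_add x
    exact (hf.differentiable (by norm_num) (x + s • v)).hasFDerivAt.comp_hasDerivAt s h1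
  have hmeas : ∀ (k : C(Torus n, ℂ)) (s : ℝ), Continuous fun q : Torus n =>
      mFourier (-b) q * k (q + torusProj n (s • v)) := fun k s =>
    (mFourier (-b)).continuous.mul (k.continuous.comp (continuous_add_const _))
  have hint : ∀ (k : C(Torus n, ℂ)) (s : ℝ), Integrable (fun q : Torus n =>
      mFourier (-b) q * k (q + torusProj n (s • v))) (torusMeasure n) := fun k s =>
    (hmeas k s).integrable_of_hasCompactSupport (HasCompactSupport.of_compactSpace _)
  -- The translated integral `∫ e_{-b}(q) f(q + s v) dq` is differentiated at `s = 0` in two ways: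
  -- here under the integral sign, below through translation invariance, which reduces the
  -- dependence on `s` to a scalar phase.
  have hd := (hasDerivAt_integral_of_dominated_loc_of_deriv_le (μ := torusMeasure n)
    (F := fun s q => mFourier (-b) q * f (q + torusProj n (s • v)))
    (F' := fun s q => mFourier (-b) q * g (q + torusProj n (s • v))) (x₀ := (0 : ℝ))
    (bound := fun _ => ‖g‖) Filter.univ_mem
    (Filter.Eventually.of_forall fun s => (hint f s).aestronglyMeasurable) (hint f 0)
    (hint g 0).aestronglyMeasurable
    (Filter.Eventually.of_forall fun q s _ => by
      rw [norm_mul]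
      have h1 : ‖mFourier (-b) q‖ ≤ 1 := by
        have := (mFourier (-b)).norm_coe_le_norm q
        rwa [mFourier_norm] at this
      calc _ ≤ 1 * ‖g‖ := mul_le_mul h1 (g.norm_coe_le_norm _) (norm_nonneg _) zero_le_one
        _ = ‖g‖ := one_mul _)
    (integrable_const _)
    (Filter.Eventually.of_forall fun q s _ => (hline q s).const_mul _)).2
  have htr : ∀ s : ℝ, ∫ q, mFourier (-b) q * f (q + torusProj n (s • v)) ∂(torusMeasure n) =
      Complex.exp ((s * (2 * Real.pi * ∑ j, (b j : ℝ) * v j) : ℝ) * Complex.I) *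
        ∫ q, mFourier (-b) q * f q ∂(torusMeasure n) := by
    intro s
    rw [← integral_add_right_eq_self (fun q => mFourier (-b) q * f q) (torusProj n (s • v)),
      ← integral_const_mul]
    refine integral_congr_ae (Filter.Eventually.of_forall fun q => ?_)
    simp only [mFourier_apply_add, mFourier_torusProj]
    have h1 : Complex.exp ((s * (2 * Real.pi * ∑ j, (b j : ℝ) * v j) : ℝ) * Complex.I) *
        Complex.exp ((2 * Real.pi * ∑ j, ((-b) j : ℝ) * (s • v) j : ℝ) * Complex.I) = 1 := by
      rw [← Complex.exp_add, ← add_mul, ← Complex.ofReal_add]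
      have h2 : s * (2 * Real.pi * ∑ j, (b j : ℝ) * v j) +
          2 * Real.pi * ∑ j, ((-b) j : ℝ) * (s • v) j = 0 := by
        simp only [Finset.mul_sum, ← Finset.sum_add_distrib]
        refine Finset.sum_eq_zero fun j _ => ?_
        simp only [Pi.neg_apply, Int.cast_neg, PiLp.smul_apply, smul_eq_mul]
        ring
      rw [h2, Complex.ofReal_zero, zero_mul, Complex.exp_zero]
    linear_combination (-(mFourier (-b) q * f (q + torusProj n (s • v)))) * h1
  simp only [htr] at hd
  have hlin : HasDerivAt (fun s : ℝ =>
      ((s * (2 * Real.pi * ∑ j, (b j : ℝ) * v j) : ℝ) : ℂ) * Complex.I)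
      (((1 * (2 * Real.pi * ∑ j, (b j : ℝ) * v j) : ℝ) : ℂ) * Complex.I) 0 :=
    (((hasDerivAt_id (0 : ℝ)).mul_const _).ofReal_comp).mul_const _
  have hd' := hlin.cexp.mul_const (∫ q, mFourier (-b) q * f q ∂(torusMeasure n))
  have h0 : torusProj n 0 = 0 := by
    funext j
    simp [torusProj]
  have := hd.unique hd'
  simp only [zero_smul, h0, add_zero] at this
  rw [this]
  simp

/-- The Laplacian is the sum of second derivatives along the standard basis; two integrations by
parts give the factor `(2πi b_j)²` for each direction. -/
theorem inner_planeWave_torusLaplacian (b : Fin n → ℤ) (f : smoothFunctions n) :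
    ⟪planeWave b, toL2 n (torusLaplacian n f)⟫_ℂ =
      ((-∑ j, (2 * Real.pi * b j) ^ 2 : ℝ) : ℂ) * ⟪planeWave b, toL2 n f.1⟫_ℂ := by
  have hf : ContDiff ℝ 2 (f.1 ∘ torusProj n) := contDiff_of_mem_smoothFunctions f.2
  have hf1 : ContDiff ℝ 1 (f.1 ∘ torusProj n) := hf.of_le (by norm_num)
  have hdf : ContDiff ℝ 1 (fderiv ℝ (f.1 ∘ torusProj n)) := hf.fderiv_right (by norm_num)
  let v : Fin n → Momentum n := fun j => EuclideanSpace.basisFun (Fin n) ℝ j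
  choose g hg using fun j => exists_lineDeriv hf1 (v j)
  have hgc : ∀ j, (g j : Torus n → ℂ) ∘ torusProj n =
      fun x => fderiv ℝ (f.1 ∘ torusProj n) x (v j) := fun j => funext (hg j)
  have hg1 : ∀ j, ContDiff ℝ 1 ((g j : Torus n → ℂ) ∘ torusProj n) := fun j => by
    rw [hgc]
    exact hdf.clm_apply contDiff_const
  choose k hk using fun j => exists_lineDeriv (hg1 j) (v j)
  have hlap : torusLaplacian n f = ∑ j, k j := by
    ext q
    obtain ⟨x, rfl⟩ := (isOpenQuotientMap_torusProj n).surjective q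
    have h1 := congrFun (torusLaplacianFun_comp (f.1 : Torus n → ℂ)) x
    change torusLaplacianFun (f.1 : Torus n → ℂ) (torusProj n x) = _
    rw [Function.comp_apply] at h1
    rw [h1, InnerProductSpace.laplacian_eq_iteratedFDeriv_orthonormalBasis _
      (EuclideanSpace.basisFun (Fin n) ℝ), ContinuousMap.sum_apply]
    refine Finset.sum_congr rfl fun j _ => ?_
    rw [hk, hgc, iteratedFDeriv_two_apply,
      fderiv_clm_apply (hdf.differentiable (by norm_num) x) (differentiableAt_const _)]
    simp [v]
  have hv : ∀ j, ∑ i, (b i : ℝ) * v j i = b j := fun j => by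
    simp [v]
  have hkj : ∀ j, ⟪planeWave b, toL2 n (k j)⟫_ℂ =
      ((-(2 * Real.pi * b j) ^ 2 : ℝ) : ℂ) * ⟪planeWave b, toL2 n f.1⟫_ℂ := by
    intro j
    rw [inner_planeWave_toL2, inner_planeWave_toL2, integral_mFourier_mul_lineDeriv (hg1 j) (hk j),
      integral_mFourier_mul_lineDeriv hf1 (hg j), hv]
    push_cast
    linear_combination ((2 * Real.pi * b j) ^ 2 *
      ∫ q, mFourier (-b) q * f.1 q ∂(torusMeasure n)) * Complex.I_sq
  rw [hlap, map_sum, inner_sum, Finset.sum_congr rfl fun j _ => hkj j, ← Finset.sum_mul,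
    ← Complex.ofReal_sum, Finset.sum_neg_distrib]

/-- The eigenvalue `(ħ²/2) |2πa|²` of the free Hamiltonian at the plane wave `ψ_a`. -/
def freeEnergy (ħ : ℝ) (a : Fin n → ℤ) : ℝ := ħ ^ 2 / 2 * ∑ j, (2 * Real.pi * a j) ^ 2

theorem freeEnergy_nonneg (ħ : ℝ) (a : Fin n → ℤ) : 0 ≤ freeEnergy ħ a :=
  mul_nonneg (by positivity) (Finset.sum_nonneg fun _ _ => sq_nonneg _)

theorem inner_smoothFreeHamiltonian {ħ : ℝ} {ψ φ : L2Torus n}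
    (h : (ψ, φ) ∈ (smoothFreeHamiltonian n ħ).graph) (a : Fin n → ℤ) :
    ⟪planeWave a, φ⟫_ℂ = freeEnergy ħ a * ⟪planeWave a, ψ⟫_ℂ := by
  obtain ⟨f, rfl, rfl⟩ := mem_graph_smoothFreeHamiltonian.mp h
  rw [inner_smul_right, inner_planeWave_torusLaplacian, freeEnergy]
  push_cast
  ring

theorem planeWave_mem_smoothFreeHamiltonian (ħ : ℝ) (a : Fin n → ℤ) :
    (planeWave a, (freeEnergy ħ a : ℂ) • planeWave a) ∈ (smoothFreeHamiltonian n ħ).graph := by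
  classical
  let f : smoothFunctions n := ⟨mFourier a, mFourier_mem_smoothFunctions a⟩
  have h : (planeWave a, (-(ħ ^ 2 / 2 : ℝ) : ℂ) • toL2 n (torusLaplacian n f)) ∈
      (smoothFreeHamiltonian n ħ).graph := mem_graph_smoothFreeHamiltonian.mpr ⟨f, rfl, rfl⟩
  convert h using 2
  -- The image of the plane wave is identified by its Fourier coefficients, which avoids
  -- differentiating the exponential pointwise.
  refine HilbertBasis.ext_inner (planeWaveBasis n) fun b => ?_
  have h1 := orthonormal_iff_ite.mp (planeWaveBasis n).orthonormal b a
  rw [planeWaveBasis_apply] at h1 ⊢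
  rw [inner_smoothFreeHamiltonian h, inner_smul_right]
  rw [planeWaveBasis_apply] at h1
  rw [h1]
  by_cases hab : b = a
  · rw [hab]
  · simp [hab]

/-- An operator that contains the eigenvectors `e i` and is contained in the maximal diagonal
operator has the latter as its closure. -/
theorem isDiagonal_closure {ι E : Type*} [NormedAddCommGroup E] [InnerProductSpace ℂ E]
    {e : HilbertBasis ι ℂ E} {l : ι → ℝ} {S : E →ₗ.[ℂ] E}
    (hS : ∀ ψ φ, (ψ, φ) ∈ S.graph → ∀ i, ⟪e i, φ⟫_ℂ = l i * ⟪e i, ψ⟫_ℂ)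
    (he : ∀ i, (e i, (l i : ℂ) • e i) ∈ S.graph) : IsDiagonal e l S.closure := by
  -- The graph of the maximal diagonal operator. It is closed, so `S` is closable and its closure
  -- lies inside `D`.
  let D : Submodule ℂ (E × E) :=
    { carrier := {x | ∀ i, ⟪e i, x.2⟫_ℂ = l i * ⟪e i, x.1⟫_ℂ}
      add_mem' := fun {x y} hx hy i => by
        rw [Prod.snd_add, Prod.fst_add, inner_add_right, inner_add_right, hx, hy, mul_add]
      zero_mem' := fun i => by simp
      smul_mem' := fun c x hx i => by
        rw [Prod.smul_snd, Prod.smul_fst, inner_smul_right, inner_smul_right, hx]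
        ring }
  have hDcl : IsClosed (D : Set (E × E)) := by
    have : (D : Set (E × E)) = ⋂ i, {x : E × E | ⟪e i, x.2⟫_ℂ = l i * ⟪e i, x.1⟫_ℂ} := by
      ext x
      simp [D]
    rw [this]
    refine isClosed_iInter fun i => isClosed_eq ?_ ?_
    · exact (innerSL ℂ (e i)).continuous.comp continuous_snd
    · exact continuous_const.mul ((innerSL ℂ (e i)).continuous.comp continuous_fst)
  have hDgraph : D.toLinearPMap.graph = D := by
    refine Submodule.toLinearPMap_graph_eq _ fun x hx h0 => ?_
    refine HilbertBasis.ext_inner e fun i => ?_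
    rw [hx i, h0, inner_zero_right, mul_zero]
  have hle : S ≤ D.toLinearPMap := by
    apply LinearPMap.le_of_le_graph
    rw [hDgraph]
    intro x hx
    exact hS x.1 x.2 hx
  have hclosable : S.IsClosable := by
    refine LinearPMap.isClosable_iff_exists_closed_extension.mpr ⟨D.toLinearPMap, ?_, hle⟩
    rw [LinearPMap.IsClosed, hDgraph]
    exact hDcl
  intro ψ φ
  rw [← hclosable.graph_closure_eq_closure_graph]
  constructor
  · intro h
    have h1 : S.graph.topologicalClosure ≤ D :=
      Submodule.topologicalClosure_minimal _ (fun x hx => hS x.1 x.2 hx) hDcl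
    exact h1 h
  · intro h
    -- Conversely, the partial sums of the joint expansion of `(ψ, φ)` are combinations of the pairs
    -- `(e i, l i • e i)` and hence lie in the graph of `S`.
    have h1 := (e.hasSum_repr ψ).prodMk (e.hasSum_repr φ)
    refine S.graph.isClosed_topologicalClosure.mem_of_tendsto h1
      (Filter.Eventually.of_forall fun F => ?_)
    refine S.graph.le_topologicalClosure (Submodule.sum_mem _ fun i _ => ?_)
    have h2 := S.graph.smul_mem (e.repr ψ i) (he i)
    convert h2 using 1
    rw [Prod.smul_mk, smul_smul, e.repr_apply_apply, e.repr_apply_apply, h, mul_comm]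

theorem isDiagonal_freeHamiltonian (n : ℕ) (ħ : ℝ) :
    IsDiagonal (planeWaveBasis n) (freeEnergy ħ) (freeHamiltonian n ħ) := by
  refine isDiagonal_closure (fun ψ φ h a => ?_) fun a => ?_
  · rw [planeWaveBasis_apply]
    exact inner_smoothFreeHamiltonian h a
  · rw [planeWaveBasis_apply]
    exact planeWave_mem_smoothFreeHamiltonian ħ a

/-- A bound on the energy confines `a` to a finite box of lattice points. This is what makes the
free resolvent compact. -/
theorem tendsto_freeEnergy {ħ : ℝ} (hħ : 0 < ħ) :
    Filter.Tendsto (freeEnergy (n := n) ħ) Filter.cofinite Filter.atTop := by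
  rw [Filter.tendsto_atTop]
  intro C
  rw [Filter.eventually_cofinite]
  set c : ℝ := ħ ^ 2 / 2 * (2 * Real.pi) ^ 2 with hc
  have hcpos : 0 < c := by positivity
  obtain ⟨N, hN⟩ := exists_nat_gt (C / c)
  refine (Set.finite_Icc (fun _ : Fin n => -(N : ℤ)) (fun _ => (N : ℤ))).subset fun a ha => ?_
  have ha' : freeEnergy ħ a < C := not_le.mp ha
  have hj : ∀ j, |a j| ≤ (N : ℤ) := fun j => by
    by_contra hlt
    have h1 : (N : ℤ) < |a j| := not_le.mp hlt
    have h2 : (a j) ^ 2 ≥ (N : ℤ) := by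
      rw [← sq_abs]
      nlinarith
    have h3 : ((a j : ℝ)) ^ 2 ≥ N := by exact_mod_cast h2
    have h4 : (2 * Real.pi * a j) ^ 2 ≤ ∑ j, (2 * Real.pi * a j) ^ 2 :=
      Finset.single_le_sum (f := fun j => (2 * Real.pi * (a j : ℝ)) ^ 2)
        (fun _ _ => sq_nonneg _) (Finset.mem_univ j)
    have h5 : c * N ≤ freeEnergy ħ a := by
      calc c * N ≤ c * (a j : ℝ) ^ 2 := mul_le_mul_of_nonneg_left h3 hcpos.le
        _ = ħ ^ 2 / 2 * (2 * Real.pi * a j) ^ 2 := by rw [hc]; ring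
        _ ≤ freeEnergy ħ a := mul_le_mul_of_nonneg_left h4 (by positivity)
    rw [div_lt_iff₀ hcpos] at hN
    linarith
  exact ⟨fun j => (abs_le.mp (hj j)).1, fun j => (abs_le.mp (hj j)).2⟩

/-! ### Multiplication operators and the perturbed Hamiltonian -/

/-- The map `V ↦ M_V`. -/
def multiplicationCLM (n : ℕ) : C(Torus n, ℂ) →L[ℂ] L2Torus n →L[ℂ] L2Torus n :=
  ((ContinuousLinearMap.mul ℂ ℂ).holderL (torusMeasure n) ∞ 2 2).comp
    (ContinuousMap.toLp ∞ (torusMeasure n) ℂ)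

theorem isSelfAdjoint_multiplicationOp (V : C(Torus n, ℝ)) :
    IsSelfAdjoint (multiplicationOp (complexify V)) := by
  rw [ContinuousLinearMap.isSelfAdjoint_iff_isSymmetric]
  intro ψ φ
  rw [L2.inner_def, L2.inner_def]
  refine integral_congr_ae ?_
  filter_upwards [multiplicationOp_coeFn (complexify V) ψ,
    multiplicationOp_coeFn (complexify V) φ] with x h1 h2
  simp only [ContinuousLinearMap.coe_coe]
  rw [h1, h2, RCLike.inner_apply, RCLike.inner_apply, map_mul,
    show (complexify V) x = ((V x : ℝ) : ℂ) from rfl, Complex.conj_ofReal]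
  ring

theorem mem_graph_hamiltonian {ħ : ℝ} (V : C(Torus n, ℝ)) (ψ φ : L2Torus n) :
    (ψ, φ) ∈ (hamiltonian ħ V).graph ↔
      (ψ, φ - multiplicationOp (complexify V) ψ) ∈ (freeHamiltonian n ħ).graph := by
  simp only [LinearPMap.mem_graph_iff]
  constructor
  · rintro ⟨⟨y, hy⟩, rfl, rfl⟩
    refine ⟨⟨y, hy.1⟩, rfl, ?_⟩
    rw [eq_sub_iff_add_eq]
    rfl
  · rintro ⟨⟨y, hy⟩, rfl, h⟩
    refine ⟨⟨y, hy, trivial⟩, rfl, ?_⟩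
    rw [eq_sub_iff_add_eq] at h
    exact h

theorem planeWave_mem_hamiltonian (ħ : ℝ) (V : C(Torus n, ℝ)) (a : Fin n → ℤ) :
    (planeWaveBasis n a, (freeEnergy ħ a : ℂ) • planeWaveBasis n a +
      multiplicationOp (complexify V) (planeWaveBasis n a)) ∈ (hamiltonian ħ V).graph := by
  rw [mem_graph_hamiltonian, add_sub_cancel_right]
  exact (isDiagonal_freeHamiltonian n ħ).basis_mem a

theorem exists_isDiagonal_hamiltonian {ħ : ℝ} (hħ : 0 < ħ) (V : C(Torus n, ℝ)) :
    ∃ (κ : Type) (f : HilbertBasis κ ℂ (L2Torus n)) (μ : κ → ℝ),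
      IsDiagonal f μ (hamiltonian ħ V) :=
  (isDiagonal_freeHamiltonian n ħ).exists_isDiagonal_add (freeEnergy_nonneg ħ)
    (tendsto_freeEnergy hħ) (isSelfAdjoint_multiplicationOp V) (mem_graph_hamiltonian V)

end FreeHamiltonian

/-! ### Membership in the quantum resolvent algebra -/

section Algebra

variable {n : ℕ}

/-- Every derivative has modulus one. Multiplication by a character therefore preserves Schwartz
functions. -/
theorem hasTemperateGrowth_exp_mul_I :
    Function.HasTemperateGrowth fun s : ℝ => Complex.exp (Complex.I * s) := by
  have hd : ∀ s : ℝ, HasDerivAt (fun s : ℝ => Complex.exp (Complex.I * s))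
      (Complex.I * Complex.exp (Complex.I * s)) s := fun s => by
    have h1 : HasDerivAt (fun s : ℝ => Complex.I * (s : ℂ)) (Complex.I * ((1 : ℝ) : ℂ)) s :=
      ((hasDerivAt_id s).ofReal_comp).const_mul _
    refine h1.cexp.congr_deriv ?_
    rw [Complex.ofReal_one]
    ring
  have hiter : ∀ k : ℕ, iteratedDeriv k (fun s : ℝ => Complex.exp (Complex.I * s)) =
      fun s : ℝ => Complex.I ^ k * Complex.exp (Complex.I * s) := by
    intro k
    induction k with
    | zero => simp
    | succ k ih =>
      rw [iteratedDeriv_succ, ih]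
      funext s
      rw [((hd s).const_mul _).deriv, pow_succ]
      ring
  refine ⟨?_, fun k => ⟨0, 1, fun s => ?_⟩⟩
  · exact (contDiff_const.mul Complex.ofRealCLM.contDiff).cexp
  · rw [norm_iteratedFDeriv_eq_norm_iteratedDeriv, hiter, norm_mul, norm_pow, Complex.norm_I,
      mul_comm Complex.I, Complex.norm_exp_ofReal_mul_I]
    simp

/-- Multiplying `h_{U,ξ,g}` by a character gives a function of the same kind. -/
theorem exists_momentumSymbol_mul_exp {U : Submodule ℝ (Momentum n)} {ξ : Momentum n}
    (hξ : ξ ∈ Uᗮ) (g : 𝓢(U, ℂ)) (η : Momentum n) : ∃ ξ' ∈ Uᗮ, ∃ g' : 𝓢(U, ℂ), ∀ p,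
      momentumSymbol U ξ' g' p = Complex.exp (Complex.I * (⟪η, p⟫_ℝ : ℝ)) * momentumSymbol U ξ g p := by
  let w : U := U.orthogonalProjectionOnto η
  have hgrow : Function.HasTemperateGrowth
      (fun u : U => Complex.exp (Complex.I * (⟪w, u⟫_ℝ : ℝ))) :=
    hasTemperateGrowth_exp_mul_I.comp (Function.hasTemperateGrowth_inner_right w)
  -- The character splits along `U`: the part of `η` orthogonal to `U` is added to `ξ`, the part in
  -- `U` is absorbed into `g`.
  refine ⟨ξ + (η - U.starProjection η),
    add_mem hξ (U.sub_starProjection_mem_orthogonal η),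
    SchwartzMap.smulLeftCLM ℂ (fun u : U => Complex.exp (Complex.I * (⟪w, u⟫_ℝ : ℝ))) g,
    fun p => ?_⟩
  have h1 : ⟪w, U.orthogonalProjectionOnto p⟫_ℝ = ⟪U.starProjection η, p⟫_ℝ :=
    Submodule.inner_orthogonalProjectionOnto_eq_of_mem_left w p
  rw [momentumSymbol, momentumSymbol, SchwartzMap.smulLeftCLM_apply_apply hgrow, h1, smul_eq_mul,
    ← mul_assoc, ← mul_assoc, ← Complex.exp_add, ← Complex.exp_add, inner_add_left, inner_sub_left]
  congr 2
  push_cast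
  ring

/-- Schwartz functions of one linear functional are of the form `h_{U,0,g}`. -/
theorem exists_momentumSymbol_eq_comp_inner (β : Momentum n) (F : 𝓢(ℝ, ℂ)) :
    ∃ (U : Submodule ℝ (Momentum n)) (g : 𝓢(U, ℂ)), ∀ p, momentumSymbol U 0 g p = F ⟪β, p⟫_ℝ := by
  let U : Submodule ℝ (Momentum n) := Submodule.span ℝ {β}
  have hβ : β ∈ U := Submodule.mem_span_singleton_self β
  have hgrow : Function.HasTemperateGrowth (fun u : U => ⟪(⟨β, hβ⟩ : U), u⟫_ℝ) :=
    Function.hasTemperateGrowth_inner_right _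
  -- On the line spanned by `β`, pairing with `β` scales lengths by `‖β‖`. For `β = 0` the space is
  -- trivial and the constant is `0⁻¹ = 0`; this case yields the constant symbols.
  have hanti : AntilipschitzWith ‖β‖₊⁻¹ (fun u : U => ⟪(⟨β, hβ⟩ : U), u⟫_ℝ) := by
    have h1 : AntilipschitzWith ‖β‖₊⁻¹ (innerSL ℝ (⟨β, hβ⟩ : U)) := by
      refine AddMonoidHomClass.antilipschitz_of_bound (innerSL ℝ (⟨β, hβ⟩ : U)) fun u => ?_
      obtain ⟨c, hc⟩ := Submodule.mem_span_singleton.mp u.2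
      have h2 : ‖u‖ = |c| * ‖β‖ := by
        rw [Submodule.coe_norm, ← hc, norm_smul, Real.norm_eq_abs]
      have h3 : ‖innerSL ℝ (⟨β, hβ⟩ : U) u‖ = |c| * ‖β‖ ^ 2 := by
        rw [innerSL_apply_apply, Submodule.coe_inner, ← hc, inner_smul_right,
          real_inner_self_eq_norm_sq, Real.norm_eq_abs, abs_mul, abs_of_nonneg (sq_nonneg ‖β‖)]
      rw [h2, h3, NNReal.coe_inv, coe_nnnorm]
      by_cases h0 : ‖β‖ = 0
      · simp [h0]
      · refine le_of_eq ?_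
        field_simp
    exact h1
  refine ⟨U, SchwartzMap.compCLMOfAntilipschitz ℝ hgrow hanti F, fun p => ?_⟩
  rw [momentumSymbol, inner_zero_left, Complex.ofReal_zero, mul_zero, Complex.exp_zero, one_mul,
    SchwartzMap.compCLMOfAntilipschitz_apply, Function.comp_apply,
    Submodule.inner_orthogonalProjectionOnto_eq_of_mem_left]

theorem weylQuantization_mem (ħ : ℝ) (f : symbolSpace n) :
    weylQuantization n ħ f ∈ resolventAlgebra n ħ :=
  NonUnitalStarSubalgebra.le_topologicalClosure _
    (NonUnitalStarAlgebra.subset_adjoin ℂ _ ⟨f, rfl⟩)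

theorem isClosed_resolventAlgebra (n : ℕ) (ħ : ℝ) :
    IsClosed (resolventAlgebra n ħ : Set (L2Torus n →L[ℂ] L2Torus n)) :=
  NonUnitalStarSubalgebra.isClosed_topologicalClosure _

theorem exists_mem_of_comp_inner (ħ : ℝ) (b : Fin n → ℤ) (β : Momentum n) (F : 𝓢(ℝ, ℂ)) :
    ∃ T ∈ resolventAlgebra n ħ, ∀ a, T (planeWave a) =
      F ⟪β, midMomentum ħ a b⟫_ℝ • planeWave (a + b) := by
  obtain ⟨U, g, hg⟩ := exists_momentumSymbol_eq_comp_inner β F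
  refine ⟨_, weylQuantization_mem ħ ⟨_, tensorSymbol_mem b U (Submodule.zero_mem _) g⟩,
    fun a => ?_⟩
  rw [isWeylQuantization n ħ b U 0 (Submodule.zero_mem _) g a, hg]

/-- With `b = 0` and `β = 0` the symbol is the constant `F 0`; a bump function supplies a Schwartz
`F` with `F 0 = 1`. -/
theorem one_mem_resolventAlgebra (n : ℕ) (ħ : ℝ) : 1 ∈ resolventAlgebra n ħ := by
  let φ : ContDiffBump (0 : ℝ) := ⟨1, 2, one_pos, one_lt_two⟩
  have hs : HasCompactSupport fun x : ℝ => ((φ x : ℝ) : ℂ) :=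
    φ.hasCompactSupport.comp_left Complex.ofReal_zero
  have hc : ContDiff ℝ ∞ fun x : ℝ => ((φ x : ℝ) : ℂ) :=
    Complex.ofRealCLM.contDiff.comp φ.contDiff
  obtain ⟨T, hT, h⟩ := exists_mem_of_comp_inner ħ (0 : Fin n → ℤ) 0 (hs.toSchwartzMap hc)
  have h1 : T = 1 := by
    refine clm_ext_planeWave fun a => ?_
    rw [h, inner_zero_left, add_zero]
    change ((φ 0 : ℝ) : ℂ) • planeWave a = planeWave a
    rw [φ.one_of_mem_closedBall (Metric.mem_closedBall_self zero_le_one), Complex.ofReal_one,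
      one_smul]
  rwa [← h1]

/-! ### The free evolution preserves the quantum resolvent algebra -/

/-- The point `b ∈ ℤⁿ ⊆ ℝⁿ`. -/
def latticePoint (b : Fin n → ℤ) : Momentum n := WithLp.toLp 2 fun j => (b j : ℝ)

/-- This is `|a + b|² - |a|² = 2 b·(a + b/2)`: the Weyl midpoint appears, so the free quantum
evolution acts on symbols without correction terms. -/
theorem freeEnergy_add_sub {ħ : ℝ} (hħ : ħ ≠ 0) (a b : Fin n → ℤ) :
    (freeEnergy ħ (a + b) - freeEnergy ħ a) / ħ =
      2 * Real.pi * ⟪latticePoint b, midMomentum ħ a b⟫_ℝ := by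
  rw [freeEnergy, freeEnergy, ← mul_sub, ← Finset.sum_sub_distrib, PiLp.inner_apply]
  rw [div_eq_iff hħ, Finset.mul_sum, Finset.mul_sum, Finset.sum_mul]
  refine Finset.sum_congr rfl fun j _ => ?_
  simp only [latticePoint, midMomentum, Pi.add_apply, Int.cast_add, RCLike.inner_apply, conj_trivial]
  ring

theorem phase_neg_mul_phase {ħ : ℝ} (hħ : ħ ≠ 0) (a b : Fin n → ℤ) (s : ℝ) :
    phase ħ (freeEnergy ħ (a + b)) (-s) * phase ħ (freeEnergy ħ a) s =
      Complex.exp (Complex.I *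
        ((s * (2 * Real.pi * ⟪latticePoint b, midMomentum ħ a b⟫_ℝ) : ℝ) : ℂ)) := by
  rw [phase, phase, ← Complex.exp_add, ← freeEnergy_add_sub hħ]
  congr 1
  push_cast
  ring

/-- The free Schrödinger group. -/
abbrev freeGroup (n : ℕ) (ħ : ℝ) (t : ℝ) : unitary (L2Torus n →L[ℂ] L2Torus n) :=
  diagonalGroup ħ (planeWaveBasis n) (freeEnergy ħ) t

theorem isSchrodingerGroup_freeGroup (n : ℕ) {ħ : ℝ} (hħ : ħ ≠ 0) :
    IsSchrodingerGroup ħ (freeHamiltonian n ħ) (freeGroup n ħ) :=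
  (isDiagonal_freeHamiltonian n ħ).isSchrodingerGroup hħ

theorem freeGroup_planeWave (ħ t : ℝ) (a : Fin n → ℤ) :
    (freeGroup n ħ t : L2Torus n →L[ℂ] L2Torus n) (planeWave a) =
      phase ħ (freeEnergy ħ a) t • planeWave a := by
  have := diagonalGroup_apply ħ (planeWaveBasis n) (freeEnergy ħ) t a
  rwa [planeWaveBasis_apply] at this

theorem freeGroup_conj_planeWave {ħ : ℝ} (hħ : ħ ≠ 0) {T : L2Torus n →L[ℂ] L2Torus n}
    {a b : Fin n → ℤ} {c : ℂ} (hT : T (planeWave a) = c • planeWave (a + b)) (s : ℝ) :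
    (freeGroup n ħ (-s) : L2Torus n →L[ℂ] L2Torus n)
      (T ((freeGroup n ħ s : L2Torus n →L[ℂ] L2Torus n) (planeWave a))) =
      (Complex.exp (Complex.I *
        ((s * (2 * Real.pi * ⟪latticePoint b, midMomentum ħ a b⟫_ℝ) : ℝ) : ℂ)) * c) •
        planeWave (a + b) := by
  rw [freeGroup_planeWave, map_smul, hT, map_smul, map_smul, freeGroup_planeWave, smul_smul,
    smul_smul, ← phase_neg_mul_phase hħ]
  congr 1
  ring

/-- A generator evolves into a generator: `h` is multiplied by the character with frequency `2πt b`,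
which keeps it in the class `h_{U,ξ,g}` with the same `U`. -/
theorem freeGroup_conj_weylQuantization_mem {ħ : ℝ} (hħ : ħ ≠ 0) (t : ℝ)
    {f : Torus n × Momentum n → ℂ} (hf : f ∈ symbolSpace n) :
    (freeGroup n ħ (-t) : L2Torus n →L[ℂ] L2Torus n) * weylQuantization n ħ ⟨f, hf⟩ *
      (freeGroup n ħ t : L2Torus n →L[ℂ] L2Torus n) ∈ resolventAlgebra n ħ := by
  induction hf using Submodule.span_induction with
  | mem f hf =>
    obtain ⟨b, U, ξ, g, hξ, rfl⟩ := hf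
    obtain ⟨ξ', hξ', g', h⟩ :=
      exists_momentumSymbol_mul_exp hξ g ((t * (2 * Real.pi)) • latticePoint b)
    have h1 : (freeGroup n ħ (-t) : L2Torus n →L[ℂ] L2Torus n) *
        weylQuantization n ħ ⟨_, tensorSymbol_mem b U hξ g⟩ *
        (freeGroup n ħ t : L2Torus n →L[ℂ] L2Torus n) =
        weylQuantization n ħ ⟨_, tensorSymbol_mem b U hξ' g'⟩ := by
      refine clm_ext_planeWave fun a => ?_
      rw [isWeylQuantization n ħ b U ξ' hξ' g' a, h]
      refine (freeGroup_conj_planeWave hħ (isWeylQuantization n ħ b U ξ hξ g a) t).trans ?_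
      rw [inner_smul_left, conj_trivial, mul_assoc t]
    rw [h1]
    exact weylQuantization_mem _ _
  | zero =>
    have : weylQuantization n ħ ⟨0, Submodule.zero_mem _⟩ = 0 := _root_.map_zero _
    rw [this, mul_zero, zero_mul]
    exact zero_mem _
  | add f g hf hg h1 h2 =>
    have : weylQuantization n ħ ⟨f + g, Submodule.add_mem _ hf hg⟩ =
        weylQuantization n ħ ⟨f, hf⟩ + weylQuantization n ħ ⟨g, hg⟩ :=
      _root_.map_add (weylQuantization n ħ) ⟨f, hf⟩ ⟨g, hg⟩
    rw [this, mul_add, add_mul]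
    exact add_mem h1 h2
  | smul k f hf h1 =>
    have : weylQuantization n ħ ⟨k • f, Submodule.smul_mem _ k hf⟩ =
        k • weylQuantization n ħ ⟨f, hf⟩ := map_smul (weylQuantization n ħ) k ⟨f, hf⟩
    rw [this, mul_smul_comm, smul_mul_assoc]
    exact SMulMemClass.smul_mem _ h1

/-- Conjugation is a norm-continuous star automorphism, so invariance passes from generators to the
generated algebra and then to its closure. -/
theorem freeGroup_conj_mem {ħ : ℝ} (hħ : ħ ≠ 0) (t : ℝ) {O : L2Torus n →L[ℂ] L2Torus n}
    (hO : O ∈ resolventAlgebra n ħ) :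
    (freeGroup n ħ (-t) : L2Torus n →L[ℂ] L2Torus n) * O *
      (freeGroup n ħ t : L2Torus n →L[ℂ] L2Torus n) ∈ resolventAlgebra n ħ := by
  have hU := isSchrodingerGroup_freeGroup n hħ
  have hstar : (freeGroup n ħ (-t) : L2Torus n →L[ℂ] L2Torus n) =
      star (freeGroup n ħ t : L2Torus n →L[ℂ] L2Torus n) := by
    rw [hU.map_neg, Unitary.coe_star]
  have heq : ∀ O, (freeGroup n ħ (-t) : L2Torus n →L[ℂ] L2Torus n) * O *
      (freeGroup n ħ t : L2Torus n →L[ℂ] L2Torus n) = timeEvolution (freeGroup n ħ) t O :=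
    fun O => by rw [timeEvolution_apply, hstar]
  have hcont : Continuous fun O => (freeGroup n ħ (-t) : L2Torus n →L[ℂ] L2Torus n) * O *
      (freeGroup n ħ t : L2Torus n →L[ℂ] L2Torus n) :=
    (continuous_const.mul continuous_id).mul continuous_const
  have hadj : ∀ O ∈ NonUnitalStarAlgebra.adjoin ℂ (Set.range (weylQuantization n ħ)),
      timeEvolution (freeGroup n ħ) t O ∈ resolventAlgebra n ħ := by
    intro O hO
    induction hO using NonUnitalStarAlgebra.adjoin_induction with
    | mem O hO =>
      obtain ⟨f, rfl⟩ := hO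
      rw [← heq]
      exact freeGroup_conj_weylQuantization_mem hħ t f.2
    | add x y _ _ hx hy => rw [_root_.map_add]; exact add_mem hx hy
    | zero => rw [_root_.map_zero]; exact zero_mem _
    | mul x y _ _ hx hy => rw [map_mul]; exact mul_mem hx hy
    | smul c x _ hx => rw [map_smul]; exact SMulMemClass.smul_mem _ hx
    | star x _ hx => rw [map_star]; exact star_mem hx
  have hcl := map_mem_closure hcont (s := (NonUnitalStarAlgebra.adjoin ℂ
    (Set.range (weylQuantization n ħ)) : Set (L2Torus n →L[ℂ] L2Torus n)))
    (t := (resolventAlgebra n ħ : Set (L2Torus n →L[ℂ] L2Torus n))) hO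
    fun O hO => by
      rw [heq]
      exact hadj O hO
  rwa [(isClosed_resolventAlgebra n ħ).closure_eq] at hcl

end Algebra

/-! ### The interaction integrals belong to the algebra -/

section Integrals

variable {n : ℕ}

/-- The integral of a character over an interval is a uniform limit of Schwartz functions. -/
theorem exists_schwartz_near_integral_exp (δ : ℝ) {ε : ℝ} (hε : 0 < ε) : ∃ F : 𝓢(ℝ, ℂ), ∀ x,
    ‖(∫ s in (0 : ℝ)..δ, Complex.exp (Complex.I * ((s * (2 * Real.pi * x) : ℝ) : ℂ))) - F x‖ ≤
      ε := by
  -- The sign encodes the orientation of the interval, so that negative `δ` is covered too.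
  let h : ℝ → ℂ := (Set.uIoc 0 δ).indicator fun _ => if 0 ≤ δ then 1 else -1
  have hmeas : MeasurableSet (Set.uIoc 0 δ) := measurableSet_uIoc
  have hint : Integrable h := by
    refine (integrable_indicator_iff hmeas).mpr ?_
    exact integrableOn_const (by simp [Set.uIoc])
  -- Schwartz functions are dense in `L¹`, and the inverse Fourier transform turns an `L¹` error
  -- into a uniform one; `F` is the inverse transform of `φ`.
  obtain ⟨φ, hφ⟩ := (SchwartzMap.denseRange_toLpCLM (E := ℝ) (F := ℂ) (p := 1) (μ := volume)
    ENNReal.one_ne_top).exists_dist_lt (memLp_one_iff_integrable.mpr hint).toLp hε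
  have hL1 : ∫ s, ‖h s - φ s‖ ≤ ε := by
    rw [dist_eq_norm, L1.norm_eq_integral_norm] at hφ
    refine le_trans (le_of_eq ?_) hφ.le
    refine integral_congr_ae ?_
    filter_upwards [Lp.coeFn_sub (memLp_one_iff_integrable.mpr hint).toLp
      (SchwartzMap.toLpCLM ℝ ℂ 1 volume φ), (memLp_one_iff_integrable.mpr hint).coeFn_toLp,
      φ.coeFn_toLp 1 volume] with s h1 h2 h3
    rw [h1, Pi.sub_apply, h2, SchwartzMap.toLpCLM_apply, h3]
  refine ⟨𝓕⁻ φ, fun x => ?_⟩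
  let E : ℝ → ℂ := fun s => Complex.exp (Complex.I * ((s * (2 * Real.pi * x) : ℝ) : ℂ))
  have hEnorm : ∀ s, ‖E s‖ = 1 := fun s => by
    simp only [E]
    rw [mul_comm Complex.I, Complex.norm_exp_ofReal_mul_I]
  have hEcont : Continuous E := by
    refine Complex.continuous_exp.comp (continuous_const.mul (Complex.continuous_ofReal.comp ?_))
    exact continuous_id.mul continuous_const
  have hEint : ∀ {k : ℝ → ℂ}, Integrable k → Integrable fun s => E s * k s := fun {k} hk =>
    hk.bdd_mul hEcont.aestronglyMeasurable (Filter.Eventually.of_forall fun s => (hEnorm s).le)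
  have h1 : ∫ s in (0 : ℝ)..δ, E s = ∫ s, E s * h s := by
    rw [intervalIntegral.intervalIntegral_eq_integral_uIoc, ← integral_indicator hmeas,
      ← integral_smul]
    refine integral_congr_ae (Filter.Eventually.of_forall fun s => ?_)
    simp only [h]
    by_cases hs : s ∈ Set.uIoc 0 δ
    · rw [Set.indicator_of_mem hs, Set.indicator_of_mem hs]
      by_cases hδ : 0 ≤ δ
      · simp [hδ]
      · simp [hδ]
    · rw [Set.indicator_of_notMem hs, Set.indicator_of_notMem hs, smul_zero, mul_zero]
  have h2 : (𝓕⁻ φ) x = ∫ s, E s * φ s := by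
    rw [SchwartzMap.fourierInv_coe, Real.fourierInv_eq']
    refine integral_congr_ae (Filter.Eventually.of_forall fun s => ?_)
    simp only [E, smul_eq_mul, RCLike.inner_apply, conj_trivial]
    congr 2
    push_cast
    ring
  change ‖(∫ s in (0 : ℝ)..δ, E s) - (𝓕⁻ φ) x‖ ≤ ε
  rw [h1, h2, ← integral_sub (hEint hint) (hEint φ.integrable)]
  refine (norm_integral_le_integral_norm _).trans (le_trans (le_of_eq ?_) hL1)
  refine integral_congr_ae (Filter.Eventually.of_forall fun s => ?_)
  simp only
  rw [← mul_sub, norm_mul, hEnorm, one_mul]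

theorem multiplicationOp_mFourier_planeWave (a b : Fin n → ℤ) :
    multiplicationOp (mFourier b) (planeWave a) = planeWave (a + b) := by
  have hmul : mFourier b * mFourier a = mFourier (a + b) := by
    ext x
    rw [ContinuousMap.mul_apply, mul_comm, mFourier_add]
  rw [planeWave, multiplicationOp_toL2, hmul, planeWave]

/-- A weighted shift is `M_{e_b}` times a diagonal operator. The norm of `M_{e_b}` is left
unevaluated: only its independence of `ε` matters. -/
theorem norm_le_of_weighted_shift {S : L2Torus n →L[ℂ] L2Torus n} {b : Fin n → ℤ}
    {c : (Fin n → ℤ) → ℂ} {ε : ℝ} (hε : 0 ≤ ε) (hc : ∀ a, ‖c a‖ ≤ ε)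
    (hS : ∀ a, S (planeWave a) = c a • planeWave (a + b)) :
    ‖S‖ ≤ ‖multiplicationOp (mFourier b)‖ * ε := by
  have h : S = multiplicationOp (mFourier b) * diagonalOp (planeWaveBasis n) c := by
    refine clm_ext_planeWave fun a => ?_
    have h1 := diagonalOp_apply (planeWaveBasis n) hc a
    rw [planeWaveBasis_apply] at h1
    rw [ContinuousLinearMap.mul_def, ContinuousLinearMap.comp_apply, h1, map_smul,
      multiplicationOp_mFourier_planeWave, hS]
  rw [h]
  refine (norm_mul_le _ _).trans ?_
  gcongr
  exact norm_diagonalOp_le _ hε hc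

/-- The integral is a weighted shift whose weight depends on the midpoint only through its pairing
with `b`. Uniform Schwartz approximation of that weight gives elements of the algebra close in
operator norm. -/
theorem conjIntegral_mFourier_mem {ħ : ℝ} (hħ : ħ ≠ 0) (b : Fin n → ℤ) (δ : ℝ) :
    conjIntegral (isSchrodingerGroup_freeGroup n hħ) (multiplicationOp (mFourier b)) δ ∈
      resolventAlgebra n ħ := by
  have hK : ∀ a, conjIntegral (isSchrodingerGroup_freeGroup n hħ) (multiplicationOp (mFourier b)) δ
      (planeWave a) = (∫ s in (0 : ℝ)..δ, Complex.exp (Complex.I *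
        ((s * (2 * Real.pi * ⟪latticePoint b, midMomentum ħ a b⟫_ℝ) : ℝ) : ℂ))) •
        planeWave (a + b) := by
    intro a
    rw [conjIntegral_apply, ← intervalIntegral.integral_smul_const]
    refine intervalIntegral.integral_congr fun s _ => ?_
    have h1 : multiplicationOp (mFourier b) (planeWave a) = (1 : ℂ) • planeWave (a + b) := by
      rw [one_smul, multiplicationOp_mFourier_planeWave]
    have h2 := freeGroup_conj_planeWave hħ h1 s
    rwa [mul_one] at h2
  have hcl := isClosed_resolventAlgebra n ħ
  rw [← SetLike.mem_coe, ← hcl.closure_eq, Metric.mem_closure_iff]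
  intro ε hε
  set M := ‖multiplicationOp (mFourier b : C(Torus n, ℂ))‖ with hM
  have hMpos : 0 < M + 1 := by positivity
  obtain ⟨F, hF⟩ := exists_schwartz_near_integral_exp δ (div_pos hε hMpos)
  obtain ⟨T, hT, hTa⟩ := exists_mem_of_comp_inner ħ b (latticePoint b) F
  refine ⟨T, hT, ?_⟩
  rw [dist_eq_norm]
  refine lt_of_le_of_lt (norm_le_of_weighted_shift (b := b) (div_pos hε hMpos).le
    (fun a => hF ⟪latticePoint b, midMomentum ħ a b⟫_ℝ) fun a => ?_) ?_
  · rw [_root_.sub_apply, hK, hTa, sub_smul]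
  · rw [← hM, mul_div_assoc', div_lt_iff₀ hMpos, mul_comm ε]
    exact mul_lt_mul_of_pos_right (lt_add_one M) hε

/-- The integral is linear and norm-continuous in `V`, and trigonometric polynomials are dense in
`C(𝕋ⁿ)`. -/
theorem conjIntegral_multiplicationOp_mem {ħ : ℝ} (hħ : ħ ≠ 0) (V : C(Torus n, ℂ)) (δ : ℝ) :
    conjIntegral (isSchrodingerGroup_freeGroup n hħ) (multiplicationOp V) δ ∈
      resolventAlgebra n ħ := by
  let L : (L2Torus n →L[ℂ] L2Torus n) →L[ℂ] (L2Torus n →L[ℂ] L2Torus n) :=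
    LinearMap.mkContinuous
      { toFun := fun B => conjIntegral (isSchrodingerGroup_freeGroup n hħ) B δ
        map_add' := fun B C => conjIntegral_add _ B C δ
        map_smul' := fun c B => conjIntegral_smul _ c B δ }
      |δ| fun B => by
        rw [mul_comm]
        exact norm_conjIntegral_le (isSchrodingerGroup_freeGroup n hħ) B δ
  let S : Submodule ℂ C(Torus n, ℂ) :=
    (resolventAlgebra n ħ).toNonUnitalSubalgebra.toSubmodule.comap
      (L.comp (multiplicationCLM n) : C(Torus n, ℂ) →ₗ[ℂ] L2Torus n →L[ℂ] L2Torus n)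
  have hcl : IsClosed (S : Set C(Torus n, ℂ)) :=
    (isClosed_resolventAlgebra n ħ).preimage (L.comp (multiplicationCLM n)).continuous
  have hle : Submodule.span ℂ (Set.range (mFourier (d := Fin n))) ≤ S := by
    rw [Submodule.span_le]
    rintro _ ⟨b, rfl⟩
    exact conjIntegral_mFourier_mem hħ b δ
  have h := Submodule.topologicalClosure_minimal _ hle hcl
  rw [span_mFourier_closure_eq_top] at h
  exact h (Submodule.mem_top : V ∈ ⊤)

/-! ### Invariance under the full evolution -/

theorem freeGroup_neg_mul_mem {ħ : ℝ} (hħ : 0 < ħ) (V : C(Torus n, ℝ))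
    {U : ℝ → unitary (L2Torus n →L[ℂ] L2Torus n)}
    (hU : IsSchrodingerGroup ħ (hamiltonian ħ V) U) (t : ℝ) :
    (freeGroup n ħ (-t) : L2Torus n →L[ℂ] L2Torus n) * (U t : L2Torus n →L[ℂ] L2Torus n) ∈
      resolventAlgebra n ħ := by
  have : Nontrivial (L2Torus n) :=
    ⟨planeWaveBasis n 0, 0, (planeWaveBasis n).orthonormal.ne_zero 0⟩
  exact neg_mul_mem_of_conjIntegral_mem (isSchrodingerGroup_freeGroup n hħ.ne') hU hħ
    (isSelfAdjoint_multiplicationOp V) (planeWave_mem_hamiltonian ħ V) (resolventAlgebra n ħ)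
    (isClosed_resolventAlgebra n ħ) (one_mem_resolventAlgebra n ħ)
    (fun t O hO => freeGroup_conj_mem hħ.ne' t hO)
    (fun δ => conjIntegral_multiplicationOp_mem hħ.ne' (complexify V) δ) t

/-- With `W = U₀(-t) U(t)` one has `U(t)* O U(t) = W* (U₀(-t) O U₀(t)) W`, a product of three
elements of the algebra. -/
theorem timeEvolution_mem {ħ : ℝ} (hħ : 0 < ħ) (V : C(Torus n, ℝ))
    {U : ℝ → unitary (L2Torus n →L[ℂ] L2Torus n)}
    (hU : IsSchrodingerGroup ħ (hamiltonian ħ V) U) (t : ℝ) {O : L2Torus n →L[ℂ] L2Torus n}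
    (hO : O ∈ resolventAlgebra n ħ) : timeEvolution U t O ∈ resolventAlgebra n ħ := by
  have hU₀ := isSchrodingerGroup_freeGroup n hħ.ne'
  have hW := freeGroup_neg_mul_mem hħ V hU t
  have h := mul_mem (mul_mem (star_mem hW) (freeGroup_conj_mem hħ.ne' t hO)) hW
  have h1 : (freeGroup n ħ t : L2Torus n →L[ℂ] L2Torus n) *
      (freeGroup n ħ (-t) : L2Torus n →L[ℂ] L2Torus n) = 1 := by
    rw [← Submonoid.coe_mul, ← hU₀.map_add, add_neg_cancel, hU₀.map_zero]
    rfl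
  have h2 : star (freeGroup n ħ (-t) : L2Torus n →L[ℂ] L2Torus n) =
      (freeGroup n ħ t : L2Torus n →L[ℂ] L2Torus n) := by
    rw [hU₀.map_neg, Unitary.coe_star, star_star]
  convert h using 1
  rw [timeEvolution_apply, star_mul, h2]
  calc _ = star (U t : L2Torus n →L[ℂ] L2Torus n) * (1 * O * 1) * U t := by
        rw [one_mul, mul_one]
    _ = _ := by
        rw [← h1]
        simp only [mul_assoc]

theorem timeEvolution_timeEvolution_neg {E : Type*} [NormedAddCommGroup E]
    [InnerProductSpace ℂ E] [CompleteSpace E] {ħ : ℝ} {H : E →ₗ.[ℂ] E}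
    {U : ℝ → unitary (E →L[ℂ] E)} (hU : IsSchrodingerGroup ħ H U) (t : ℝ) (O : E →L[ℂ] E) :
    timeEvolution U t (timeEvolution U (-t) O) = O := by
  have h1 : star (U t : E →L[ℂ] E) * (U t : E →L[ℂ] E) = 1 := (Unitary.mem_iff.mp (U t).2).1
  rw [timeEvolution_apply, timeEvolution_apply, hU.map_neg, Unitary.coe_star, star_star]
  calc _ = (star (U t : E →L[ℂ] E) * (U t : E →L[ℂ] E)) * O *
        (star (U t : E →L[ℂ] E) * (U t : E →L[ℂ] E)) := by simp only [mul_assoc]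
    _ = O := by rw [h1, one_mul, mul_one]

end Integrals

end TorusResolvent

end

theorem mainTheorem11 (n : ℕ) (ħ : ℝ) (hħ : 0 < ħ) (V : C(TorusResolvent.Torus n, ℝ)) :
    IsSelfAdjoint (TorusResolvent.hamiltonian ħ V) ∧
    (∃! U : ℝ → unitary (TorusResolvent.L2Torus n →L[ℂ] TorusResolvent.L2Torus n),
      TorusResolvent.IsSchrodingerGroup ħ (TorusResolvent.hamiltonian ħ V) U) ∧
    ∀ U : ℝ → unitary (TorusResolvent.L2Torus n →L[ℂ] TorusResolvent.L2Torus n),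
      TorusResolvent.IsSchrodingerGroup ħ (TorusResolvent.hamiltonian ħ V) U →
      ∀ t : ℝ,
        TorusResolvent.timeEvolution U t ''
            (TorusResolvent.resolventAlgebra n ħ : Set _) =
          (TorusResolvent.resolventAlgebra n ħ : Set _) := by
  obtain ⟨κ, f, μ, hdiag⟩ := TorusResolvent.exists_isDiagonal_hamiltonian hħ V
  refine ⟨hdiag.isSelfAdjoint, hdiag.existsUnique_group hħ.ne', fun U hU t => ?_⟩
  refine Set.Subset.antisymm ?_ fun O hO => ?_
  · rintro _ ⟨O, hO, rfl⟩
    exact TorusResolvent.timeEvolution_mem hħ V hU t hO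
  -- The reverse inclusion is invariance at time `-t`, which supplies the preimage.
  · exact ⟨_, TorusResolvent.timeEvolution_mem hħ V hU (-t) hO,
      TorusResolvent.timeEvolution_timeEvolution_neg hU t O⟩
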